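/- **Setting.** An episodic MDP $M$ with horizon $H$ on finite spaces $\mathcal S,\mathcal A$ has transition kernels $\mathbb P_h(\cdot\mid x,a)$ and random rewards with values in $[0,1]$ and mean $r_h(x,a)$, $h\in[H]$. It is a *linear MDP* with feature map $\phi:\mathcal S\times\mathcal A\to\mathbb R^d$ if $\|\phi(x,a)\|\le 1$ for all $(x,a)$ and for each $h$ there are a $d$-tuple $\mu_h$ of signed measures on $\mathcal S$ and $\theta_h\in\mathbb R^d$ with $\mathbb P_h(\cdot\mid x,a)=\langle\phi(x,a),\mu_h(\cdot)\rangle$, $r_h(x,a)=\langle\phi(x,a),\theta_h\rangle$ for all $(x,a)$ and $\max\{\|\mu_h(\mathcal S)\|,\|\theta_h\|\}\le\sqrt d$. A policy $\pi=\{\pi_h\}$ assigns to each $h$ and $x$ a distribution $\pi_h(\cdot\mid x)$ on $\mathcal A$; $V_h^\pi(x)$ is the expected sum of the rewards of steps $h,\dots,H$ under $\pi$ from $x_h=x$ (with $V^\pi_{H+1}=0$), $V_h^*=\sup_\pi V_h^\pi$, and $\pi$ is optimal if $V_h^{\pi}=V_h^*$ for all $h$. Put $[\mathbb V_hV](x,a)=\max\{1,\operatorname{Var}_{x'\sim\mathbb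 P_h(\cdot\mid x,a)}V(x')\}$ and $\|u\|_\Lambda=\sqrt{u^\top\Lambda u}$. **Theorem 3 (Lower bound for MDPs).** There are universal constants $c,c_0,C>0$ such that for all integers $H\ge1$, $d\ge2$, $K$ and all $\delta\in(0,1)$ with $K\ge C\,d^4\log(2Hd/\delta)$ there exist finite spaces $\mathcal S,\mathcal A$, a feature map $\phi$, an initial distribution $\xi$, a behavior policy $\beta$ and a nonempty class $\mathcal M$ of linear MDPs with feature map $\phi$, such that the following holds for the dataset $\mathcal D=\{(x_h^\tau,a_h^\tau,r_h^\tau)\}_{h\in[H],\tau\in[K]}$ of $K$ independent trajectories collected by $\beta$ from $x_1\sim\xi$. (i) For every $M\in\mathcal M$ and $h\in[H]$, the covariance matrix of the features at step $h$ under $\beta$ satisfies $\lambda_{\min}\big(\mathbb E_{\beta,h}[\phi\phi^\top]\big)\ge c_0/d^2$, and $M$ has an optimal policy. (ii) For every (measurable) data-dependent policy $\widehat\pi=\widehat\pi(\mathcal D)$, every $\lambda>0$, every $M\in\mathcal M$ and every optimal policy $\pi^*$ of $M$, with probability at least $1-\delta$ over $\mathcal D$ collected in $M$, $$\sup_{M'\in\mathcal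 M}\mathbb E_{M'}\big[V_1^*(x_1)-V_1^{\widehat\pi}(x_1)\big]\;\ge\;c\sqrt d\,\sum_{h=1}^H\mathbb E_{\pi^*}\|\phi(x_h,a_h)\|_{(\mathbf Z_h^*)^{-1}},$$ where $$\mathbf Z_h^*=\sum_{\tau=1}^K\frac{\phi(x_h^\tau,a_h^\tau)\phi(x_h^\tau,a_h^\tau)^\top}{[\mathbb V_hV_{h+1}^*](x_h^\tau,a_h^\tau)}+\lambda I_d .$$ On the left the values are those of $M'$, and $\mathbb E_{M'}$ is over the dataset collected in $M'$ and an independent $x_1\sim\xi$; on the right $\mathbb E_{\pi^*}$, $V^*$ and $\mathbb V_h$ are those of $M$, and $\mathbb E_{\pi^*}$ is over $x_1\sim\xi$ and the trajectory of $\pi^*$. -/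

import Mathlib

open MeasureTheory
open scoped Matrix

noncomputable section

namespace OfflineRL

/-- Markov policies for horizon `H`: `π h x` is a probability vector on the actions.
Steps are numbered `0, …, H - 1`. -/
abbrev Policy (H : ℕ) (S A : Type) [Fintype A] : Type :=
  {π : Fin H → S → A → ℝ // ∀ h x, π h x ∈ stdSimplex ℝ A}

/-- An episodic MDP with horizon `H` on finite state and action spaces. The reward observed
at `(x, a)` in step `h` is drawn from the law `R h x a` on `[0, 1]`; a deterministic reward is
the case of a Dirac measure. -/
structure MDP (H : ℕ) (S A : Type) [Fintype S] where
  /-- `P h x a x'` is the probability to move from `x` to `x'` under `a` in step `h` -/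
  P : Fin H → S → A → S → ℝ
  P_mem : ∀ h x a, P h x a ∈ stdSimplex ℝ S
  /-- law of the observed reward -/
  R : Fin H → S → A → Measure ℝ
  R_prob : ∀ h x a, IsProbabilityMeasure (R h x a)
  R_mem : ∀ h x a, ∀ᵐ r ∂(R h x a), r ∈ Set.Icc (0 : ℝ) 1

/-- A trajectory `(x_h, a_h, r_h)_h`. -/
abbrev Traj (H : ℕ) (S A : Type) : Type := Fin H → (S × A) × ℝ

/-- A dataset of `K` trajectories. -/
abbrev Dataset (K H : ℕ) (S A : Type) : Type := Fin K → Traj H S A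

/-- The weighted norm `‖u‖_Λ = √(uᵀ Λ u)`. -/
def wnorm {d : ℕ} (Λ : Matrix (Fin d) (Fin d) ℝ) (u : EuclideanSpace ℝ (Fin d)) : ℝ :=
  √(u.ofLp ⬝ᵥ (Λ *ᵥ u.ofLp))

namespace MDP

variable {H : ℕ} {S A : Type} [Fintype S] [Fintype A]

/-- The expected reward `r_h(x, a)`. -/
def r (M : MDP H S A) (h : Fin H) (x : S) (a : A) : ℝ := ∫ y, y ∂(M.R h x a)

/-- `(P_h V)(x, a)`. -/
def PV (M : MDP H S A) (h : Fin H) (V : S → ℝ) (x : S) (a : A) : ℝ :=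
  ∑ x', M.P h x a x' * V x'

/-- Conditional variance `[Var_h V](x, a)`. -/
def condVar (M : MDP H S A) (h : Fin H) (V : S → ℝ) (x : S) (a : A) : ℝ :=
  M.PV h (fun x' => V x' ^ 2) x a - (M.PV h V x a) ^ 2

/-- Truncated variance `max {1, [Var_h V](x, a)}`. -/
def truncVar (M : MDP H S A) (h : Fin H) (V : S → ℝ) (x : S) (a : A) : ℝ :=
  max 1 (M.condVar h V x a)

/-- `M.value π h x` is the expected sum of the rewards of the steps `h, …, H - 1` under `π`,
started from `x` at step `h`; it is `0` for `h ≥ H`. -/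
def value (M : MDP H S A) (π : Policy H S A) (h : ℕ) (x : S) : ℝ :=
  if hh : h < H then
    ∑ a, π.1 ⟨h, hh⟩ x a *
      (M.r ⟨h, hh⟩ x a + ∑ x', M.P ⟨h, hh⟩ x a x' * M.value π (h + 1) x')
  else 0
termination_by H - h

/-- The optimal value `V*_h(x)`: the supremum over all policies. -/
def optValue (M : MDP H S A) (h : ℕ) (x : S) : ℝ := ⨆ π : Policy H S A, M.value π h x

/-- `π` attains the optimal value at every step and every state. -/
def IsOptimal (M : MDP H S A) (π : Policy H S A) : Prop :=
  ∀ (h : Fin H) (x : S) (π' : Policy H S A), M.value π' h x ≤ M.value π h x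

/-- Linear MDP with feature map `φ`. On a finite state space a `d`-tuple of signed measures is a
map `μ : S → ℝᵈ`, and its value on the whole space is `∑ x', μ x'`. -/
def IsLinear {d : ℕ} (M : MDP H S A) (φ : S → A → EuclideanSpace ℝ (Fin d)) : Prop :=
  (∀ x a, ‖φ x a‖ ≤ 1) ∧
  ∀ h, ∃ (μ : S → EuclideanSpace ℝ (Fin d)) (θ : EuclideanSpace ℝ (Fin d)),
    (∀ x a x', M.P h x a x' = inner ℝ (φ x a) (μ x')) ∧
    (∀ x a, M.r h x a = inner ℝ (φ x a) θ) ∧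
    ‖∑ x', μ x'‖ ≤ √(d : ℝ) ∧ ‖θ‖ ≤ √(d : ℝ)

/-- Probability of the state-action path `s` when `x_0 ∼ ξ`, `a_h ∼ π_h(· | x_h)` and
`x_{h+1} ∼ P_h(· | x_h, a_h)`. -/
def pathProb (M : MDP H S A) (ξ : S → ℝ) (π : Policy H S A) (s : Fin H → S × A) : ℝ :=
  ∏ h : Fin H,
    (if h.val = 0 then ξ (s h).1
      else
        let g : Fin H := ⟨h.val - 1, lt_of_le_of_lt (Nat.sub_le _ _) h.isLt⟩
        M.P g (s g).1 (s g).2 (s h).1)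
    * π.1 h (s h).1 (s h).2

/-- `E_π[f(x_h, a_h)]` with `x_0 ∼ ξ`. -/
def expect (M : MDP H S A) (ξ : S → ℝ) (π : Policy H S A) (h : Fin H) (f : S → A → ℝ) : ℝ :=
  ∑ s : Fin H → S × A, M.pathProb ξ π s * f (s h).1 (s h).2

/-- The covariance matrix `E_{π,h}[φ(x, a) φ(x, a)ᵀ]`. -/
def covMatrix {d : ℕ} (M : MDP H S A) (φ : S → A → EuclideanSpace ℝ (Fin d)) (ξ : S → ℝ)
    (π : Policy H S A) (h : Fin H) : Matrix (Fin d) (Fin d) ℝ :=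
  Matrix.of fun i j => M.expect ξ π h fun x a => φ x a i * φ x a j

/-- `Z*_h = ∑_τ φ(x_h^τ, a_h^τ) φ(x_h^τ, a_h^τ)ᵀ / max {1, [Var_h V*_{h+1}](x_h^τ, a_h^τ)} + lam I`
for the dataset `D`. -/
def Zstar {d K : ℕ} (M : MDP H S A) (φ : S → A → EuclideanSpace ℝ (Fin d)) (lam : ℝ)
    (D : Dataset K H S A) (h : Fin H) : Matrix (Fin d) (Fin d) ℝ :=
  (∑ τ : Fin K,
    (M.truncVar h (M.optValue (h.val + 1)) (D τ h).1.1 (D τ h).1.2)⁻¹ •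
      Matrix.vecMulVec (φ (D τ h).1.1 (D τ h).1.2).ofLp (φ (D τ h).1.1 (D τ h).1.2).ofLp)
  + lam • (1 : Matrix (Fin d) (Fin d) ℝ)

variable [MeasurableSpace S] [MeasurableSpace A]

/-- Law of one trajectory collected by the policy `π`: a state-action path drawn with
probability `pathProb`, and, given the path, independent rewards `r_h ∼ R h x_h a_h`. -/
def trajLaw (M : MDP H S A) (ξ : S → ℝ) (π : Policy H S A) : Measure (Traj H S A) :=
  ∑ s : Fin H → S × A, ENNReal.ofReal (M.pathProb ξ π s) •
    Measure.pi fun h => (Measure.dirac (s h)).prod (M.R h (s h).1 (s h).2)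

/-- Law of a dataset of `K` independent trajectories collected by the policy `π`. -/
def dataLaw (M : MDP H S A) (K : ℕ) (ξ : S → ℝ) (π : Policy H S A) :
    Measure (Dataset K H S A) :=
  Measure.pi fun _ => M.trajLaw ξ π

/-- The expected suboptimality `E_M[V*_1(x_1) - V_1^{π̂}(x_1)]` of the data-dependent policy
`alg`, for a dataset collected by `β` and an independent initial state `x_1 ∼ ξ`. -/
def expSubopt {K : ℕ} (M : MDP H S A) (ξ : S → ℝ) (β : Policy H S A)
    (alg : Dataset K H S A → Policy H S A) : ℝ :=
  ∫ D, ∑ x, ξ x * (M.optValue 0 x - M.value (alg D) 0 x) ∂(M.dataLaw K ξ β)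

end MDP

end OfflineRL

end

open MeasureTheory
open scoped Matrix

noncomputable section

namespace OfflineRL

/-! ### Products of finite mixtures -/

/-! The hard instances are sequences of `H` decoupled linear bandits. With n = d - 1, the actions
are the vertices of the cube {0,1}^n, the next state is a fair coin whatever is played, and the
reward of step h is Bernoulli with mean 1/2 + ε ∑ ±a_i, the signs being given by an unknown vertex
`u h`. As actions do not influence states, V* is constant on the states, its variance vanishes and
every truncated variance is 1 (`truncVar_eq`). Regret is ε times the expected number of wrong
coordinates, over all steps (`regret_eq`).

Lower bound on the left side: the behavior policy plays only the origin (probability 1/2) and the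
unit vectors (1/(2n) each), so the sign of a coordinate is seen only through its own unit vector.
With ε = √(n/K)/4, flipping one sign keeps the Hellinger affinity of the data laws at 7/8 or more
(`sum_min_likelihood_ge`), and Assouad's method gives an instance with regret at least εHn/4
(`exists_expSubopt_ge`). This number does not depend on the observed data.

Upper bound on the right side: by Chernoff and a union bound, with probability at least 1 - δ every
probing action occurs at least half as often as expected (`sum_likelihood_good_ge`). All features
are combinations of the probed ones, so every elliptic norm is then at most √(8n²/K)
(`wnorm_Zstar_inv_le`). Multiplied by H√d this has order Hn√(n/K), the same as εHn.

Rewards are bits, so the law of the data is a finite sum of Dirac masses (`dataLaw_eq`), and all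
probability reduces to finite sums. -/

theorem pi_sum_smul {ι κ : Type*} [Fintype ι] [DecidableEq ι] [Fintype κ] {X : ι → Type*}
    [∀ i, MeasurableSpace (X i)] (w : ι → κ → ENNReal) (hw : ∀ i k, w i k ≠ ⊤)
    (m : ∀ i, κ → Measure (X i)) [∀ i k, IsFiniteMeasure (m i k)] :
    Measure.pi (fun i => ∑ k, w i k • m i k) =
      ∑ f : ι → κ, (∏ i, w i (f i)) • Measure.pi (fun i => m i (f i)) := by
  have : ∀ i, IsFiniteMeasure (∑ k, w i k • m i k) := by
    intro i
    refine ⟨?_⟩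
    rw [Measure.finsetSum_apply]
    refine ENNReal.sum_lt_top.2 fun k _ => ?_
    exact ENNReal.mul_lt_top (lt_top_iff_ne_top.2 (hw i k)) (measure_lt_top _ _)
  refine Measure.pi_eq fun s _ => ?_
  simp only [Measure.finsetSum_apply, Measure.smul_apply, Measure.pi_pi, smul_eq_mul,
    ← Finset.prod_mul_distrib]
  rw [Fintype.prod_sum]

theorem pi_dirac_eq {ι : Type*} [Fintype ι] {X : ι → Type*} [∀ i, MeasurableSpace (X i)]
    (x : ∀ i, X i) : Measure.pi (fun i => Measure.dirac (x i)) = Measure.dirac x := by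
  classical
  refine Measure.pi_eq fun s hs => ?_
  rw [Measure.dirac_apply' _ (MeasurableSet.univ_pi hs)]
  simp only [Measure.dirac_apply' _ (hs _)]
  by_cases h : ∀ i, x i ∈ s i
  · simp [Set.indicator, h]
  · obtain ⟨i, hi⟩ := not_forall.1 h
    rw [Finset.prod_eq_zero (Finset.mem_univ i) (by simp [hi])]
    simp only [Set.indicator, Set.mem_univ_pi, h, if_false]

theorem pi_sum_dirac {ι κ : Type*} [Fintype ι] [DecidableEq ι] [Fintype κ] {X : ι → Type*}
    [∀ i, MeasurableSpace (X i)] (w : ι → κ → ℝ) (hw : ∀ i k, 0 ≤ w i k)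
    (g : ∀ i, κ → X i) :
    Measure.pi (fun i => ∑ k, ENNReal.ofReal (w i k) • Measure.dirac (g i k)) =
      ∑ f : ι → κ, ENNReal.ofReal (∏ i, w i (f i)) • Measure.dirac (fun i => g i (f i)) := by
  rw [pi_sum_smul _ (fun _ _ => ENNReal.ofReal_ne_top)]
  simp only [pi_dirac_eq, ENNReal.ofReal_prod_of_nonneg (fun i _ => hw i _)]

theorem integral_sum_dirac {Ω X : Type*} [Fintype Ω] [MeasurableSpace X]
    [MeasurableSingletonClass X] (p : Ω → ℝ) (hp : ∀ ω, 0 ≤ p ω) (g : Ω → X) (f : X → ℝ) :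
    ∫ x, f x ∂(∑ ω, ENNReal.ofReal (p ω) • Measure.dirac (g ω)) = ∑ ω, p ω * f (g ω) := by
  rw [integral_finsetSum_measure fun ω _ => ?_]
  · simp [integral_smul_measure, ENNReal.toReal_ofReal (hp _)]
  · exact (integrable_dirac (by simp)).smul_measure ENNReal.ofReal_ne_top

/-- Each Dirac mass located in `E` contributes its full weight. No measurability of `E` is needed,
so the event of the main theorem can be used as it stands. -/
theorem sum_dirac_apply_ge {Ω X : Type*} [Fintype Ω] [MeasurableSpace X]
    [MeasurableSingletonClass X] (p : Ω → ℝ) (hp : ∀ ω, 0 ≤ p ω) (g : Ω → X) (E : Set X)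
    (s : Finset Ω) (hs : ∀ ω ∈ s, g ω ∈ E) :
    ENNReal.ofReal (∑ ω ∈ s, p ω) ≤
      (∑ ω, ENNReal.ofReal (p ω) • Measure.dirac (g ω)) E := by
  rw [Measure.finsetSum_apply, ENNReal.ofReal_sum_of_nonneg fun ω _ => hp ω]
  calc ∑ ω ∈ s, ENNReal.ofReal (p ω)
      = ∑ ω ∈ s, (ENNReal.ofReal (p ω) • Measure.dirac (g ω)) E := by
        refine Finset.sum_congr rfl fun ω hω => ?_
        simp [hs ω hω]
    _ ≤ _ := Finset.sum_le_univ_sum_of_nonneg fun ω => bot_le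

/-! ### The methods of Le Cam and Assouad on finite sample spaces -/

/-- For p ≤ q the right side is p + q/4, and (p + q/4)² - pq = (p - q/4)². -/
theorem sqrt_mul_le_min {p q : ℝ} (hp : 0 ≤ p) (hq : 0 ≤ q) :
    √(p * q) ≤ 3 / 4 * min p q + (p + q) / 4 := by
  rw [Real.sqrt_le_left (by positivity)]
  rcases le_total p q with h | h
  · rw [min_eq_left h]; nlinarith [sq_nonneg (p - q / 4)]
  · rw [min_eq_right h]; nlinarith [sq_nonneg (q - p / 4)]

/-- A linear substitute for Le Cam's inequality, obtained by summing a pointwise bound. It is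
informative once the affinity exceeds 1/2; affinity 7/8 yields overlap 1/2. -/
theorem sum_min_ge_affinity {Ω : Type*} [Fintype Ω] {p q : Ω → ℝ} (hp : ∀ ω, 0 ≤ p ω)
    (hq : ∀ ω, 0 ≤ q ω) (hp1 : ∑ ω, p ω = 1) (hq1 : ∑ ω, q ω = 1) :
    4 / 3 * (∑ ω, √(p ω * q ω) - 1 / 2) ≤ ∑ ω, min (p ω) (q ω) := by
  have h : ∑ ω, √(p ω * q ω) ≤ ∑ ω, (3 / 4 * min (p ω) (q ω) + (p ω + q ω) / 4) :=
    Finset.sum_le_sum fun ω _ => sqrt_mul_le_min (hp ω) (hq ω)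
  rw [Finset.sum_add_distrib, ← Finset.mul_sum, ← Finset.sum_div, Finset.sum_add_distrib,
    hp1, hq1] at h
  linarith

/-- Flip the sign of one coordinate of a vertex of the cube. -/
def flipAt {J : Type*} [DecidableEq J] (j : J) (u : J → Bool) : J → Bool :=
  Function.update u j (!u j)

theorem flipAt_involutive {J : Type*} [DecidableEq J] (j : J) :
    Function.Involutive (flipAt j) := by
  intro u
  simp [flipAt]

theorem flipAt_same {J : Type*} [DecidableEq J] (j : J) (u : J → Bool) :
    flipAt j u j = !u j := by
  simp [flipAt]

theorem flipAt_of_ne {J : Type*} [DecidableEq J] {j k : J} (h : k ≠ j) (u : J → Bool) :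
    flipAt j u k = u k := by
  simp [flipAt, h]

/-- Average over all vertices and pair each `u` with its `j`-th flip. The two losses of one decision
sum to 1, so a pair costs at least the overlap of its two laws. Some vertex does no better than the
average. -/
theorem exists_assouad {J Ω : Type*} [Fintype J] [DecidableEq J] [Fintype Ω]
    (p : (J → Bool) → Ω → ℝ) (e : J → Ω → Bool → ℝ)
    (he : ∀ j ω b, 0 ≤ e j ω b) (he1 : ∀ j ω b, e j ω b + e j ω (!b) = 1) (κ : ℝ)
    (hκ : ∀ j u, κ ≤ ∑ ω, min (p u ω) (p (flipAt j u) ω)) :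
    ∃ u, κ / 2 * Fintype.card J ≤ ∑ ω, p u ω * ∑ j, e j ω (u j) := by
  have key : ∀ j, ∑ _u : J → Bool, κ / 2 ≤ ∑ u, ∑ ω, p u ω * e j ω (u j) := by
    intro j
    have hflip : ∑ u, ∑ ω, p u ω * e j ω (u j) =
        ∑ u, ∑ ω, p (flipAt j u) ω * e j ω (!u j) := by
      rw [← Equiv.sum_comp (flipAt_involutive j).toPerm]
      simp only [Function.Involutive.coe_toPerm, flipAt_same]
    have : ∑ _u : J → Bool, κ ≤
        ∑ u, ∑ ω, (p u ω * e j ω (u j) + p (flipAt j u) ω * e j ω (!u j)) := by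
      refine Finset.sum_le_sum fun u _ => (hκ j u).trans (Finset.sum_le_sum fun ω _ => ?_)
      have h1 := mul_le_mul_of_nonneg_right (min_le_left (p u ω) (p (flipAt j u) ω))
        (he j ω (u j))
      have h2 := mul_le_mul_of_nonneg_right (min_le_right (p u ω) (p (flipAt j u) ω))
        (he j ω (!u j))
      calc min (p u ω) (p (flipAt j u) ω)
          = min (p u ω) (p (flipAt j u) ω) * (e j ω (u j) + e j ω (!u j)) := by
            rw [he1, mul_one]
        _ ≤ _ := by linarith
    simp only [Finset.sum_add_distrib] at this
    rw [← hflip] at this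
    rw [← Finset.sum_div]
    linarith
  have hsum : ∑ _u : J → Bool, κ / 2 * Fintype.card J ≤
      ∑ u, ∑ ω, p u ω * ∑ j, e j ω (u j) := by
    calc ∑ _u : J → Bool, κ / 2 * Fintype.card J = ∑ _j : J, ∑ _u : J → Bool, κ / 2 := by
          simp; ring
      _ ≤ ∑ j, ∑ u, ∑ ω, p u ω * e j ω (u j) := Finset.sum_le_sum fun j _ => key j
      _ = _ := by
          rw [Finset.sum_comm]
          refine Finset.sum_congr rfl fun u _ => ?_
          rw [Finset.sum_comm]
          simp [Finset.mul_sum]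
  obtain ⟨u, _, hu⟩ := Finset.exists_le_of_sum_le Finset.univ_nonempty hsum
  exact ⟨u, hu⟩

/-! ### A Chernoff bound for independent samples from a finite distribution -/

/-- Exponential Markov inequality for e^(-N), N being the number of hits of `B`. One sample
contributes the factor 1 - (1 - 1/e) P(B) ≤ exp(-3ρ/5), and 3/5 - 1/2 = 1/10. -/
theorem chernoff_lower {K : ℕ} {Y : Type*} [Fintype Y] (q : Y → ℝ) (hq : ∀ y, 0 ≤ q y)
    (hq1 : ∑ y, q y = 1) (B : Y → Prop) [DecidablePred B] (ρ : ℝ)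
    (hρ : ρ ≤ ∑ y with B y, q y) :
    ∑ ω : Fin K → Y with ((Finset.univ.filter fun τ => B (ω τ)).card : ℝ) < K * ρ / 2,
      ∏ τ, q (ω τ) ≤ Real.exp (-(K * ρ / 10)) := by
  set g : Y → ℝ := fun y => q y * Real.exp (if B y then -1 else 0) with hg
  have hexp : Real.exp (-1) ≤ 2 / 5 := by
    rw [Real.exp_neg]
    have := Real.exp_one_gt_d9
    rw [inv_le_comm₀ (by positivity) (by norm_num)]
    norm_num
    linarith
  have hg0 : 0 ≤ ∑ y, g y :=
    Finset.sum_nonneg fun y _ => mul_nonneg (hq y) (Real.exp_pos _).le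
  have hs : 0 ≤ ∑ y with B y, q y := Finset.sum_nonneg fun y _ => hq y
  have hgsum : ∑ y, g y ≤ Real.exp (-(3 / 5 * ρ)) := by
    have h1 : ∑ y, g y = 1 - (1 - Real.exp (-1)) * ∑ y with B y, q y := by
      trans ∑ y, q y - (1 - Real.exp (-1)) * ∑ y with B y, q y
      swap
      · rw [hq1]
      rw [Finset.sum_filter, Finset.mul_sum, ← Finset.sum_sub_distrib]
      refine Finset.sum_congr rfl fun y _ => ?_
      by_cases h : B y
      · simp [hg, h]; ring
      · simp [hg, h]
    have h2 := Real.add_one_le_exp (-(3 / 5 * ρ))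
    rw [h1]
    nlinarith
  have hpt : ∀ ω : Fin K → Y, ∏ τ, g (ω τ) = (∏ τ, q (ω τ)) *
      Real.exp (-((Finset.univ.filter fun τ => B (ω τ)).card : ℝ)) := by
    intro ω
    rw [Finset.prod_mul_distrib, ← Real.exp_sum, Finset.card_filter]
    congr 2
    push_cast
    rw [← Finset.sum_neg_distrib]
    exact Finset.sum_congr rfl fun τ _ => by split_ifs <;> simp
  calc ∑ ω : Fin K → Y with ((Finset.univ.filter fun τ => B (ω τ)).card : ℝ) < K * ρ / 2,
        ∏ τ, q (ω τ)
      ≤ ∑ ω : Fin K → Y with ((Finset.univ.filter fun τ => B (ω τ)).card : ℝ) < K * ρ / 2,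
        Real.exp (K * ρ / 2) * ∏ τ, g (ω τ) := by
        refine Finset.sum_le_sum fun ω hω => ?_
        have hω' := (Finset.mem_filter.1 hω).2
        rw [hpt, mul_left_comm, ← Real.exp_add]
        refine le_mul_of_one_le_right (Finset.prod_nonneg fun τ _ => hq _) ?_
        rw [Real.one_le_exp_iff]
        linarith
    _ ≤ ∑ ω : Fin K → Y, Real.exp (K * ρ / 2) * ∏ τ, g (ω τ) :=
        Finset.sum_le_univ_sum_of_nonneg fun ω => mul_nonneg (Real.exp_pos _).le
          (Finset.prod_nonneg fun τ _ => mul_nonneg (hq _) (Real.exp_pos _).le)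
    _ = Real.exp (K * ρ / 2) * (∑ y, g y) ^ K := by
        rw [← Finset.mul_sum, ← Fintype.prod_sum (fun (_ : Fin K) y => g y)]
        simp
    _ ≤ Real.exp (K * ρ / 2) * Real.exp (-(3 / 5 * ρ)) ^ K := by gcongr
    _ = Real.exp (-(K * ρ / 10)) := by
        rw [← Real.exp_nat_mul, ← Real.exp_add]
        congr 1
        ring

/-! ### The hard instances -/

/-- The probing actions: the origin and the unit vectors of the cube. -/
def probe {n : ℕ} (o : Option (Fin n)) : Fin n → Bool := fun i => decide (o = some i)

/-- Probabilities of the probing actions under the behavior policy. -/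
def probeWeight (n : ℕ) (o : Option (Fin n)) : ℝ := o.elim (1 / 2) fun _ => 1 / (2 * n)

/-- The probability vector of the behavior policy on the actions. -/
def probeDist (n : ℕ) (a : Fin n → Bool) : ℝ :=
  ∑ o, probeWeight n o * if a = probe o then 1 else 0

theorem probe_injective {n : ℕ} : Function.Injective (probe (n := n)) := by
  intro o o' h
  have h' : ∀ i, o = some i ↔ o' = some i := fun i => by
    have := congrFun h i
    simpa [probe] using this
  exact Option.ext h'

theorem probeWeight_nonneg (n : ℕ) (o : Option (Fin n)) : 0 ≤ probeWeight n o := by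
  cases o <;> simp [probeWeight]

theorem sum_probeDist_mul {n : ℕ} (f : (Fin n → Bool) → ℝ) :
    ∑ a, probeDist n a * f a = ∑ o, probeWeight n o * f (probe o) := by
  simp only [probeDist, Finset.sum_mul]
  rw [Finset.sum_comm]
  refine Finset.sum_congr rfl fun o _ => ?_
  rw [Finset.sum_eq_single (probe o)] <;> simp +contextual

theorem sum_probeWeight_mul {n : ℕ} (f : Option (Fin n) → ℝ) :
    ∑ o, probeWeight n o * f o = f none / 2 + (∑ i, f (some i)) / (2 * n) := by
  rw [Fintype.sum_option]
  simp only [probeWeight, Option.elim, ← Finset.mul_sum]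
  ring

theorem sum_probeWeight {n : ℕ} (hn : n ≠ 0) : ∑ o, probeWeight n o = 1 := by
  have := sum_probeWeight_mul (n := n) fun _ => 1
  simp only [mul_one] at this
  rw [this]
  simp
  field_simp
  norm_num

theorem probeDist_nonneg (n : ℕ) (a : Fin n → Bool) : 0 ≤ probeDist n a :=
  Finset.sum_nonneg fun o _ => mul_nonneg (probeWeight_nonneg n o) (by split_ifs <;> simp)

theorem sum_probeDist {n : ℕ} (hn : n ≠ 0) : ∑ a, probeDist n a = 1 := by
  have := sum_probeDist_mul (n := n) fun _ => 1
  simp only [mul_one] at this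
  rw [this, sum_probeWeight hn]

/-- The behavior policy: it draws a probing action, regardless of step and state. -/
def behavior (n H : ℕ) (hn : n ≠ 0) : Policy H Bool (Fin n → Bool) :=
  ⟨fun _ _ => probeDist n, fun _ _ => ⟨probeDist_nonneg n, sum_probeDist hn⟩⟩

/-- Mean reward of the action `a` when the optimal action is `v`. -/
def meanReward {n : ℕ} (ε : ℝ) (v a : Fin n → Bool) : ℝ :=
  1 / 2 + ε * ∑ i, if a i then (if v i then 1 else -1) else 0

/-- The probabilities of a Bernoulli distribution. -/
def bernWeight (p : ℝ) (b : Bool) : ℝ := if b then p else 1 - p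

/-- The value of a Bernoulli reward. -/
def bit (b : Bool) : ℝ := if b then 1 else 0

/-- The Bernoulli distribution on `{0, 1}`. -/
def bernLaw (p : ℝ) : Measure ℝ :=
  ∑ b, ENNReal.ofReal (bernWeight p b) • Measure.dirac (bit b)

theorem meanReward_mem {n : ℕ} {ε : ℝ} (hε : 0 ≤ ε) (hεn : ε * n ≤ 1 / 2)
    (v a : Fin n → Bool) : meanReward ε v a ∈ Set.Icc (0 : ℝ) 1 := by
  have h : |∑ i, (if a i then (if v i then 1 else -1) else 0 : ℝ)| ≤ n := by
    calc _ ≤ ∑ i, |(if a i then (if v i then 1 else -1) else 0 : ℝ)| :=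
          Finset.abs_sum_le_sum_abs _ _
      _ ≤ ∑ _i : Fin n, (1 : ℝ) := Finset.sum_le_sum fun i _ => by split_ifs <;> simp
      _ = n := by simp
  rw [abs_le] at h
  rw [Set.mem_Icc, meanReward]
  constructor <;> nlinarith

theorem bernWeight_nonneg {p : ℝ} (hp : p ∈ Set.Icc (0 : ℝ) 1) (b : Bool) :
    0 ≤ bernWeight p b := by
  cases b <;> simp [bernWeight, hp.1, hp.2]

theorem sum_bernWeight (p : ℝ) : ∑ b, bernWeight p b = 1 := by
  simp [bernWeight]

theorem isProbabilityMeasure_bernLaw {p : ℝ} (hp : p ∈ Set.Icc (0 : ℝ) 1) :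
    IsProbabilityMeasure (bernLaw p) := by
  refine ⟨?_⟩
  rw [bernLaw, Measure.finsetSum_apply]
  simp only [Measure.smul_apply, measure_univ, smul_eq_mul, mul_one]
  rw [← ENNReal.ofReal_sum_of_nonneg fun b _ => bernWeight_nonneg hp b, sum_bernWeight,
    ENNReal.ofReal_one]

theorem integral_bernLaw {p : ℝ} (hp : p ∈ Set.Icc (0 : ℝ) 1) : ∫ y, y ∂(bernLaw p) = p := by
  rw [bernLaw, integral_sum_dirac _ (bernWeight_nonneg hp) _ fun y => y]
  simp [bernWeight, bit]

theorem ae_bernLaw (p : ℝ) : ∀ᵐ r ∂(bernLaw p), r ∈ Set.Icc (0 : ℝ) 1 := by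
  rw [bernLaw, ae_iff, Measure.finsetSum_apply]
  refine Finset.sum_eq_zero fun b _ => ?_
  cases b <;> simp [bit]

/-- The hard instance with parameter `u`: the next state is uniform, and the reward of step `h`
is Bernoulli with optimal action `u h`. -/
def hardMDP {n H : ℕ} {ε : ℝ} (hε : 0 ≤ ε) (hεn : ε * n ≤ 1 / 2) (u : Fin H × Fin n → Bool) :
    MDP H Bool (Fin n → Bool) where
  P _ _ _ _ := 1 / 2
  P_mem _ _ _ := ⟨fun _ => by norm_num, by simp⟩
  R h _ a := bernLaw (meanReward ε (fun i => u (h, i)) a)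
  R_prob _ _ _ := isProbabilityMeasure_bernLaw (meanReward_mem hε hεn _ _)
  R_mem _ _ _ := ae_bernLaw _

/-- The feature map of the hard instances. -/
def feature {n : ℕ} (_ : Bool) (a : Fin n → Bool) : EuclideanSpace ℝ (Fin (n + 1)) :=
  WithLp.toLp 2 (Fin.cons (1 / √2) fun i => bit (a i) / √(2 * n))

theorem feature_zero {n : ℕ} (x : Bool) (a : Fin n → Bool) : feature x a 0 = 1 / √2 := rfl

theorem feature_succ {n : ℕ} (x : Bool) (a : Fin n → Bool) (i : Fin n) :
    feature x a i.succ = bit (a i) / √(2 * n) := rfl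

section

variable {n H : ℕ} {ε : ℝ} (hε : 0 ≤ ε) (hεn : ε * n ≤ 1 / 2) (u : Fin H × Fin n → Bool)

theorem hardMDP_r (h : Fin H) (x : Bool) (a : Fin n → Bool) :
    (hardMDP hε hεn u).r h x a = meanReward ε (fun i => u (h, i)) a :=
  integral_bernLaw (meanReward_mem hε hεn _ _)

/-- The constant coordinate carries the transitions and the base reward 1/2; the others carry the
signed part of the mean. The scale √(2n) makes the feature norm at most 1, and εn ≤ 1/2 keeps θ
bounded. The total mass of μ has norm √2, so d ≥ 2 is just enough. -/
theorem hardMDP_isLinear (hn : n ≠ 0) : (hardMDP hε hεn u).IsLinear (feature (n := n)) := by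
  have hn' : (0 : ℝ) < n := by positivity
  have hn1 : (1 : ℝ) ≤ n := by exact_mod_cast Nat.one_le_iff_ne_zero.2 hn
  have h2 : (√2 : ℝ) ^ 2 = 2 := Real.sq_sqrt (by norm_num)
  have h2n : √(2 * n : ℝ) ^ 2 = 2 * n := Real.sq_sqrt (by positivity)
  refine ⟨fun x a => ?_, fun h => ⟨fun _ => WithLp.toLp 2 (Fin.cons (√2 / 2) fun _ => 0),
    WithLp.toLp 2 (Fin.cons (√2 / 2) fun i => √(2 * n) * (ε * if u (h, i) then 1 else -1)),
    fun x a x' => ?_, fun x a => ?_, ?_, ?_⟩⟩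
  · rw [EuclideanSpace.norm_eq, Real.sqrt_le_left zero_le_one, one_pow, Fin.sum_univ_succ]
    have : ∑ i, ‖feature x a (Fin.succ i)‖ ^ 2 ≤ ∑ _i : Fin n, 1 / (2 * n : ℝ) := by
      refine Finset.sum_le_sum fun i _ => ?_
      rw [feature_succ, Real.norm_eq_abs, sq_abs, div_pow, h2n]
      gcongr
      cases a i <;> simp [bit]
    simp only [Finset.sum_const, Finset.card_univ, Fintype.card_fin, nsmul_eq_mul] at this
    rw [feature_zero, Real.norm_eq_abs, sq_abs, div_pow, h2]
    have h3 : (n : ℝ) * (1 / (2 * n)) = 1 / 2 := by field_simp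
    linarith
  · rw [PiLp.inner_apply, Fin.sum_univ_succ]
    simp only [feature_zero, feature_succ, hardMDP]
    simp
    field_simp
  · rw [PiLp.inner_apply, Fin.sum_univ_succ, hardMDP_r]
    simp only [feature_zero, feature_succ, meanReward, Finset.mul_sum]
    simp only [RCLike.inner_apply, conj_trivial, Fin.cons_zero, Fin.cons_succ]
    congr 1
    · field_simp
    · refine Finset.sum_congr rfl fun i _ => ?_
      have : √(2 * n : ℝ) ≠ 0 := by positivity
      cases a i <;> simp [bit]
      field_simp
  · rw [EuclideanSpace.norm_eq]
    refine Real.sqrt_le_sqrt ?_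
    rw [Fin.sum_univ_succ]
    simp
    nlinarith [sq_abs (√2 : ℝ)]
  · rw [EuclideanSpace.norm_eq]
    refine Real.sqrt_le_sqrt ?_
    rw [Fin.sum_univ_succ]
    have : ∀ i : Fin n, (√(2 * n) * (ε * if u (h, i) then 1 else -1)) ^ 2 =
        2 * n * ε ^ 2 := by
      intro i
      rw [mul_pow, h2n]
      split_ifs <;> ring
    simp only [Fin.cons_zero, Fin.cons_succ, Real.norm_eq_abs, sq_abs, this, div_pow, h2]
    simp only [Finset.sum_const, Finset.card_univ, Fintype.card_fin, nsmul_eq_mul]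
    push_cast
    nlinarith [mul_nonneg hε hn'.le]

/-! ### Values and regret of the hard instances -/

/-- The maximal mean reward when the optimal action is `v`. -/
def bestReward (ε : ℝ) (v : Fin n → Bool) : ℝ := 1 / 2 + ε * ∑ i, if v i then 1 else 0

/-- Playing a coordinate with sign -1 and omitting one with sign +1 both cost ε, so the gap is ε
times a Hamming distance. -/
theorem bestReward_sub_meanReward (ε : ℝ) (v a : Fin n → Bool) :
    bestReward ε v - meanReward ε v a = ε * ∑ i, if a i = v i then 0 else 1 := by
  rw [bestReward, meanReward, add_sub_add_left_eq_sub, ← mul_sub, ← Finset.sum_sub_distrib]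
  congr 1
  refine Finset.sum_congr rfl fun i _ => ?_
  cases a i <;> cases v i <;> norm_num

/-- The mean reward of step `h` in the state `x` under the policy `π`. -/
def stepReward (ε : ℝ) (u : Fin H × Fin n → Bool) (π : Policy H Bool (Fin n → Bool))
    (h : Fin H) (x : Bool) : ℝ :=
  ∑ a, π.1 h x a * meanReward ε (fun i => u (h, i)) a

theorem value_of_lt (π : Policy H Bool (Fin n → Bool)) (h : Fin H) (x : Bool) :
    (hardMDP hε hεn u).value π h x =
      stepReward ε u π h x + (∑ x', (hardMDP hε hεn u).value π (h + 1) x') / 2 := by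
  rw [MDP.value, dif_pos h.2]
  simp only [hardMDP_r, mul_add, Finset.sum_add_distrib]
  congr 1
  have hP : ∀ k x a x', (hardMDP hε hεn u).P k x a x' = 1 / 2 := fun _ _ _ _ => rfl
  simp only [hP, ← Finset.mul_sum]
  rw [← Finset.sum_mul, (π.2 _ x).2]
  ring

theorem value_of_ge (π : Policy H Bool (Fin n → Bool)) {h : ℕ} (hh : H ≤ h) (x : Bool) :
    (hardMDP hε hεn u).value π h x = 0 := by
  rw [MDP.value, dif_neg (by omega)]

theorem sum_filter_le_succ (f : Fin H → ℝ) (h : Fin H) :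
    ∑ k : Fin H with h.val ≤ k.val, f k = f h + ∑ k : Fin H with h.val + 1 ≤ k.val, f k := by
  rw [← Finset.sum_insert (by simp)]
  congr 1
  ext k
  simp [Fin.ext_iff]
  omega

/-- The optimal value of the hard instance from step `h` on. -/
def bestValue (ε : ℝ) (u : Fin H × Fin n → Bool) (h : ℕ) : ℝ :=
  ∑ k : Fin H with h ≤ k.val, bestReward ε fun i => u (k, i)

theorem stepReward_le (hε : 0 ≤ ε) (π : Policy H Bool (Fin n → Bool)) (h : Fin H) (x : Bool) :
    stepReward ε u π h x ≤ bestReward ε fun i => u (h, i) := by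
  calc stepReward ε u π h x ≤ ∑ a, π.1 h x a * bestReward ε fun i => u (h, i) := by
        refine Finset.sum_le_sum fun a _ => mul_le_mul_of_nonneg_left ?_ ((π.2 h x).1 a)
        rw [← sub_nonneg, bestReward_sub_meanReward]
        exact mul_nonneg hε (Finset.sum_nonneg fun i _ => by split_ifs <;> simp)
    _ = _ := by rw [← Finset.sum_mul, (π.2 h x).2, one_mul]

theorem value_le (π : Policy H Bool (Fin n → Bool)) (h : ℕ) (x : Bool) :
    (hardMDP hε hεn u).value π h x ≤ bestValue ε u h := by
  induction hk : H - h generalizing h x with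
  | zero =>
    rw [value_of_ge hε hεn u π (by omega), bestValue, Finset.sum_eq_zero]
    intro k hk'
    have := (Finset.mem_filter.1 hk').2
    omega
  | succ m ih =>
    have hh : h < H := by omega
    have h1 := value_of_lt hε hεn u π ⟨h, hh⟩ x
    have h2 := stepReward_le u hε π ⟨h, hh⟩ x
    have h3 := sum_filter_le_succ (fun k => bestReward ε fun i => u (k, i)) ⟨h, hh⟩
    have h4 := ih (h + 1) true (by omega)
    have h5 := ih (h + 1) false (by omega)
    simp only [Fintype.sum_bool] at h1 h3
    rw [bestValue] at h4 h5 ⊢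
    linarith

/-- The policy that always plays the optimal action. -/
def greedy (u : Fin H × Fin n → Bool) : Policy H Bool (Fin n → Bool) :=
  ⟨fun h _ a => if a = fun i => u (h, i) then 1 else 0, fun h x =>
    ⟨fun a => by dsimp only; split_ifs <;> simp, by simp⟩⟩

theorem value_greedy (h : ℕ) (x : Bool) :
    (hardMDP hε hεn u).value (greedy u) h x = bestValue ε u h := by
  induction hk : H - h generalizing h x with
  | zero =>
    rw [value_of_ge hε hεn u _ (by omega), bestValue, Finset.sum_eq_zero]
    intro k hk'
    have := (Finset.mem_filter.1 hk').2
    omega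
  | succ m ih =>
    have hh : h < H := by omega
    have h1 := value_of_lt hε hεn u (greedy u) ⟨h, hh⟩ x
    have h2 : stepReward ε u (greedy u) ⟨h, hh⟩ x = bestReward ε fun i => u (⟨h, hh⟩, i) := by
      have := bestReward_sub_meanReward ε (fun i => u (⟨h, hh⟩, i)) fun i => u (⟨h, hh⟩, i)
      simp [stepReward, greedy] at this ⊢
      linarith
    have h3 := sum_filter_le_succ (fun k => bestReward ε fun i => u (k, i)) ⟨h, hh⟩
    have h4 := ih (h + 1) true (by omega)
    have h5 := ih (h + 1) false (by omega)
    simp only [Fintype.sum_bool] at h1 h3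
    rw [bestValue] at h4 h5 ⊢
    linarith

theorem greedy_isOptimal : (hardMDP hε hεn u).IsOptimal (greedy u) := by
  intro h x π
  rw [value_greedy]
  exact value_le hε hεn u π h x

theorem optValue_eq (h : ℕ) (x : Bool) :
    (hardMDP hε hεn u).optValue h x = bestValue ε u h := by
  have : Nonempty (Policy H Bool (Fin n → Bool)) := ⟨greedy u⟩
  refine le_antisymm (ciSup_le fun π => value_le hε hεn u π h x) ?_
  rw [← value_greedy hε hεn u h x]
  exact le_ciSup (f := fun π => (hardMDP hε hεn u).value π h x)
    ⟨bestValue ε u h, by rintro _ ⟨π, rfl⟩; exact value_le hε hεn u π h x⟩ (greedy u)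

/-- The optimal value does not depend on the state, so its variance is 0 and the truncation at 1 is
active. Hence `Zstar` is the unweighted regularized Gram matrix. -/
theorem truncVar_eq (h : Fin H) (k : ℕ) (x : Bool) (a : Fin n → Bool) :
    (hardMDP hε hεn u).truncVar h ((hardMDP hε hεn u).optValue k) x a = 1 := by
  have : (hardMDP hε hεn u).condVar h ((hardMDP hε hεn u).optValue k) x a = 0 := by
    simp only [MDP.condVar, MDP.PV, optValue_eq]
    simp [hardMDP]
  rw [MDP.truncVar, this]
  norm_num

/-- The probability, at a uniform state, that `π` disagrees with the bit `b` in the coordinate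
`j.2` of the action of step `j.1`. -/
def errProb (π : Policy H Bool (Fin n → Bool)) (j : Fin H × Fin n) (b : Bool) : ℝ :=
  ∑ x, 1 / 2 * ∑ a, π.1 j.1 x a * if a j.2 = b then 0 else 1

theorem errProb_nonneg (π : Policy H Bool (Fin n → Bool)) (j : Fin H × Fin n) (b : Bool) :
    0 ≤ errProb π j b :=
  Finset.sum_nonneg fun x _ => mul_nonneg (by norm_num) <| Finset.sum_nonneg fun a _ =>
    mul_nonneg ((π.2 j.1 x).1 a) (by split_ifs <;> simp)

theorem errProb_add_not (π : Policy H Bool (Fin n → Bool)) (j : Fin H × Fin n) (b : Bool) :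
    errProb π j b + errProb π j (!b) = 1 := by
  have h : ∀ x, ∑ a, π.1 j.1 x a * (if a j.2 = b then 0 else 1) +
      ∑ a, π.1 j.1 x a * (if a j.2 = !b then 0 else 1) = 1 := by
    intro x
    rw [← Finset.sum_add_distrib]
    refine Eq.trans ?_ (π.2 j.1 x).2
    refine Finset.sum_congr rfl fun a _ => ?_
    cases a j.2 <;> cases b <;> simp
  simp only [errProb, ← Finset.sum_add_distrib, ← mul_add, h]
  simp

/-- The state at every step is uniform whatever the policy, so by backward induction the regret is
the sum of the one-step gaps, each a scaled Hamming distance. -/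
theorem regret_eq (π : Policy H Bool (Fin n → Bool)) :
    ∑ x : Bool, 1 / 2 * ((hardMDP hε hεn u).optValue 0 x - (hardMDP hε hεn u).value π 0 x) =
      ε * ∑ j, errProb π j (u j) := by
  have key : ∀ h : ℕ,
      ∑ x : Bool, 1 / 2 * (bestValue ε u h - (hardMDP hε hεn u).value π h x) =
        ∑ k : Fin H with h ≤ k.val,
          ∑ x, 1 / 2 * (bestReward ε (fun i => u (k, i)) - stepReward ε u π k x) := by
    intro h
    induction hk : H - h generalizing h with
    | zero =>
      have : (Finset.univ.filter fun k : Fin H => h ≤ k.val) = ∅ := by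
        ext k
        simp
        omega
      simp [bestValue, this, value_of_ge hε hεn u π (show H ≤ h by omega)]
    | succ m ih =>
      have hh : h < H := by omega
      have h1 := value_of_lt hε hεn u π ⟨h, hh⟩
      have h3 := sum_filter_le_succ (fun k => bestReward ε fun i => u (k, i)) ⟨h, hh⟩
      have h4 := sum_filter_le_succ (fun k => ∑ x, 1 / 2 *
        (bestReward ε (fun i => u (k, i)) - stepReward ε u π k x)) ⟨h, hh⟩
      have h5 := ih (h + 1) (by omega)
      have h6 := h1 true
      have h7 := h1 false
      simp only [Fintype.sum_bool] at h4 h5 h6 h7 ⊢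
      rw [h4, ← h5]
      simp only [bestValue] at h3 ⊢
      rw [h3, h6, h7]
      ring
  simp only [optValue_eq]
  rw [key 0, Fintype.sum_prod_type, Finset.mul_sum, Finset.filter_true_of_mem (by simp)]
  refine Finset.sum_congr rfl fun k _ => ?_
  simp only [errProb]
  rw [Finset.sum_comm, Finset.mul_sum]
  refine Finset.sum_congr rfl fun x _ => ?_
  rw [← Finset.mul_sum, mul_left_comm]
  congr 1
  have : bestReward ε (fun i => u (k, i)) - stepReward ε u π k x =
      ∑ a, π.1 k x a * (bestReward ε (fun i => u (k, i)) -
        meanReward ε (fun i => u (k, i)) a) := by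
    simp only [mul_sub, Finset.sum_sub_distrib]
    rw [← Finset.sum_mul, (π.2 k x).2, one_mul]
    rfl
  rw [this, Finset.sum_comm, Finset.mul_sum]
  refine Finset.sum_congr rfl fun a _ => ?_
  rw [bestReward_sub_meanReward, ← Finset.mul_sum]
  ring

/-! ### Trajectories of the hard instances -/

/-- The uniform distribution on the two states. -/
def unifState : Bool → ℝ := fun _ => 1 / 2

theorem unifState_mem : unifState ∈ stdSimplex ℝ Bool :=
  ⟨fun _ => by norm_num [unifState], by simp [unifState]⟩

theorem pathProb_eq (π : Policy H Bool (Fin n → Bool)) (s : Fin H → Bool × (Fin n → Bool)) :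
    (hardMDP hε hεn u).pathProb unifState π s = ∏ h, 1 / 2 * π.1 h (s h).1 (s h).2 := by
  simp only [MDP.pathProb, unifState, hardMDP, ite_self]

theorem expect_eq (π : Policy H Bool (Fin n → Bool)) (h : Fin H)
    (f : Bool → (Fin n → Bool) → ℝ) :
    (hardMDP hε hεn u).expect unifState π h f = ∑ x, 1 / 2 * ∑ a, π.1 h x a * f x a := by
  have hs : ∀ s : Fin H → Bool × (Fin n → Bool),
      (hardMDP hε hεn u).pathProb unifState π s * f (s h).1 (s h).2 =
        ∏ k, (1 / 2 * π.1 k (s k).1 (s k).2 * if k = h then f (s k).1 (s k).2 else 1) := by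
    intro s
    simp only [pathProb_eq, Finset.prod_mul_distrib, Finset.prod_ite_eq', Finset.mem_univ,
      if_true]
  simp only [MDP.expect, hs]
  rw [← Fintype.prod_sum (fun k (z : Bool × (Fin n → Bool)) =>
    (1 / 2 * π.1 k z.1 z.2 * if k = h then f z.1 z.2 else 1)), Finset.prod_eq_single h]
  · simp [Fintype.sum_prod_type, mul_assoc, Finset.mul_sum]
  · intro k _ hk
    simp only [hk, if_false, mul_one, Fintype.sum_prod_type, ← Finset.mul_sum]
    simp [(π.2 k _).2]
  · simp

theorem expect_le (π : Policy H Bool (Fin n → Bool)) (h : Fin H)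
    (f : Bool → (Fin n → Bool) → ℝ) (b : ℝ) (hf : ∀ x a, f x a ≤ b) :
    (hardMDP hε hεn u).expect unifState π h f ≤ b := by
  rw [expect_eq]
  have : ∀ x, ∑ a, π.1 h x a * f x a ≤ b := fun x => by
    calc ∑ a, π.1 h x a * f x a ≤ ∑ a, π.1 h x a * b :=
          Finset.sum_le_sum fun a _ => mul_le_mul_of_nonneg_left (hf x a) ((π.2 h x).1 a)
      _ = b := by rw [← Finset.sum_mul, (π.2 h x).2, one_mul]
  rw [Fintype.sum_bool]
  linarith [this true, this false]

theorem feature_dot (x : Bool) (a : Fin n → Bool) (v : Fin (n + 1) → ℝ) :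
    (feature x a).ofLp ⬝ᵥ v = v 0 / √2 + ∑ i, bit (a i) * (v i.succ / √(2 * n)) := by
  rw [dotProduct, Fin.sum_univ_succ, feature_zero]
  congr 1
  · ring
  · exact Finset.sum_congr rfl fun i _ => by rw [feature_succ]; ring

theorem feature_probe_none_dot (x : Bool) (v : Fin (n + 1) → ℝ) :
    (feature x (probe (n := n) none)).ofLp ⬝ᵥ v = v 0 / √2 := by
  rw [feature_dot]
  simp [probe, bit]

theorem feature_probe_some_dot (x : Bool) (j : Fin n) (v : Fin (n + 1) → ℝ) :
    (feature x (probe (some j))).ofLp ⬝ᵥ v = v 0 / √2 + v j.succ / √(2 * n) := by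
  rw [feature_dot]
  simp [probe, bit]

theorem vecMulVec_quadForm {d : ℕ} (w v : Fin d → ℝ) :
    v ⬝ᵥ (Matrix.vecMulVec w w *ᵥ v) = (w ⬝ᵥ v) ^ 2 := by
  rw [Matrix.vecMulVec_mulVec, dotProduct_smul, dotProduct_comm v w, sq]
  simp

theorem covMatrix_eq (hn : n ≠ 0) (h : Fin H) :
    (hardMDP hε hεn u).covMatrix feature unifState (behavior n H hn) h =
      ∑ o, probeWeight n o • Matrix.vecMulVec (feature true (probe o)).ofLp
        (feature true (probe o)).ofLp := by
  ext i j
  simp only [MDP.covMatrix, expect_eq, Matrix.of_apply, behavior, Matrix.sum_apply,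
    Matrix.smul_apply, Matrix.vecMulVec_apply, smul_eq_mul]
  rw [← sum_probeDist_mul fun a => feature true a i * feature true a j, Fintype.sum_bool]
  have : ∀ a : Fin n → Bool, feature false a = feature true a := fun _ => rfl
  simp only [this]
  ring

/-- In the quadratic form, the origin controls the constant coordinate of `v`, and each other
coordinate is a difference of two probed values. -/
theorem covMatrix_posSemidef (hn : n ≠ 0) (h : Fin H) :
    ((hardMDP hε hεn u).covMatrix feature unifState (behavior n H hn) h -
      ((1 / 12) / ((n + 1 : ℕ) : ℝ) ^ 2) • (1 : Matrix (Fin (n + 1)) (Fin (n + 1)) ℝ)).PosSemidef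
    := by
  have hn' : (0 : ℝ) < n := by positivity
  have hn1 : (1 : ℝ) ≤ n := by exact_mod_cast Nat.one_le_iff_ne_zero.2 hn
  rw [covMatrix_eq]
  refine Matrix.PosSemidef.of_dotProduct_mulVec_nonneg ?_ fun v => ?_
  · refine Matrix.IsHermitian.ext fun i j => ?_
    simp [Matrix.sum_apply, Matrix.vecMulVec_apply, Matrix.one_apply, mul_comm, eq_comm]
  have hq : v ⬝ᵥ ((∑ o, probeWeight n o • Matrix.vecMulVec (feature true (probe o)).ofLp
        (feature true (probe o)).ofLp) *ᵥ v) =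
      (v 0 / √2) ^ 2 / 2 + (∑ j : Fin n, (v 0 / √2 + v j.succ / √(2 * n)) ^ 2) / (2 * n) := by
    rw [Matrix.sum_mulVec, dotProduct_sum]
    simp only [Matrix.smul_mulVec, dotProduct_smul, vecMulVec_quadForm, smul_eq_mul]
    rw [sum_probeWeight_mul fun o => ((feature true (probe o)).ofLp ⬝ᵥ v) ^ 2]
    simp only [feature_probe_none_dot, feature_probe_some_dot]
  have hv : v ⬝ᵥ v = v 0 ^ 2 + ∑ j : Fin n, v j.succ ^ 2 := by
    rw [dotProduct, Fin.sum_univ_succ]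
    simp only [sq]
  rw [star_trivial, Matrix.sub_mulVec, dotProduct_sub, hq, Matrix.smul_mulVec,
    Matrix.one_mulVec, dotProduct_smul, hv, smul_eq_mul, sub_nonneg]
  set x := v 0 / √2 with hx
  set T := ∑ j : Fin n, (x + v j.succ / √(2 * n)) ^ 2 with hT
  have hT0 : 0 ≤ T := Finset.sum_nonneg fun j _ => sq_nonneg _
  have h0 : v 0 ^ 2 = 2 * x ^ 2 := by
    rw [hx, div_pow, Real.sq_sqrt (by norm_num)]
    ring
  have hj : ∑ j : Fin n, v j.succ ^ 2 ≤ 4 * n * T + 4 * n ^ 2 * x ^ 2 := by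
    -- With y = v_j/√(2n), this is y² ≤ 2(x + y)² + 2x² multiplied by 2n.
    have : ∀ j : Fin n, v j.succ ^ 2 ≤ 4 * n * (x + v j.succ / √(2 * n)) ^ 2 + 4 * n * x ^ 2 := by
      intro j
      have h1 : v j.succ ^ 2 = 2 * n * (v j.succ / √(2 * n)) ^ 2 := by
        rw [div_pow, Real.sq_sqrt (by positivity)]
        field_simp
      rw [h1]
      nlinarith [mul_nonneg hn'.le (sq_nonneg (2 * x + v j.succ / √(2 * n)))]
    calc _ ≤ ∑ j : Fin n, (4 * n * (x + v j.succ / √(2 * n)) ^ 2 + 4 * n * x ^ 2) :=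
          Finset.sum_le_sum fun j _ => this j
      _ = _ := by
          rw [Finset.sum_add_distrib, ← Finset.mul_sum, ← hT, Finset.sum_const, Finset.card_univ,
            Fintype.card_fin, nsmul_eq_mul]
          ring
  push_cast
  have hx2 := sq_nonneg x
  calc 1 / 12 / ((n : ℝ) + 1) ^ 2 * (v 0 ^ 2 + ∑ j : Fin n, v j.succ ^ 2)
      ≤ 1 / 12 / (n : ℝ) ^ 2 * (6 * n ^ 2 * x ^ 2 + 4 * n * T) := by
        gcongr ?_ * ?_
        · gcongr
          linarith
        · nlinarith [mul_nonneg hx2 (by nlinarith : (0 : ℝ) ≤ n ^ 2 - 1)]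
    _ = x ^ 2 / 2 + T / (3 * n) := by
        field_simp
        ring
    _ ≤ x ^ 2 / 2 + T / (2 * n) := by
        gcongr
        norm_num

/-! ### Elliptic norms of the features -/

/-- Features are affine in the action, and the origin and the unit vectors span the cube affinely.
-/
theorem feature_dot_eq (x x' : Bool) (a : Fin n → Bool) (v : Fin (n + 1) → ℝ) :
    (feature x a).ofLp ⬝ᵥ v =
      (1 - ∑ i, bit (a i)) * ((feature x' (probe none)).ofLp ⬝ᵥ v) +
        ∑ i, bit (a i) * ((feature x' (probe (some i))).ofLp ⬝ᵥ v) := by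
  simp only [feature_probe_none_dot, feature_probe_some_dot, mul_add, Finset.sum_add_distrib]
  rw [feature_dot, ← Finset.sum_mul]
  ring

theorem feature_dot_sq_le (hn : n ≠ 0) (x x' : Bool) (a : Fin n → Bool)
    (v : Fin (n + 1) → ℝ) :
    ((feature x a).ofLp ⬝ᵥ v) ^ 2 ≤
      2 * n ^ 2 * ((feature x' (probe none)).ofLp ⬝ᵥ v) ^ 2 +
        2 * n * ∑ i, ((feature x' (probe (some i))).ofLp ⬝ᵥ v) ^ 2 := by
  have hn1 : (1 : ℝ) ≤ n := by exact_mod_cast Nat.one_le_iff_ne_zero.2 hn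
  rw [feature_dot_eq x x']
  set y := (feature x' (probe none)).ofLp ⬝ᵥ v
  set z : Fin n → ℝ := fun i => (feature x' (probe (some i))).ofLp ⬝ᵥ v
  have hb : ∀ i, bit (a i) = 0 ∨ bit (a i) = 1 := fun i => by cases a i <;> simp [bit]
  have hb0 : 0 ≤ ∑ i, bit (a i) := Finset.sum_nonneg fun i _ => by
    rcases hb i with h | h <;> rw [h]; norm_num
  have hb1 : ∑ i, bit (a i) ≤ n := by
    calc ∑ i, bit (a i) ≤ ∑ _i : Fin n, (1 : ℝ) := Finset.sum_le_sum fun i _ => by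
          rcases hb i with h | h <;> rw [h]; norm_num
      _ = n := by simp
  have h1 : (1 - ∑ i, bit (a i)) ^ 2 ≤ (n : ℝ) ^ 2 := by
    rw [sq_le_sq, abs_of_nonneg (by linarith : (0 : ℝ) ≤ n), abs_le]
    constructor <;> linarith
  have h2 : (∑ i, bit (a i) * z i) ^ 2 ≤ n * ∑ i, z i ^ 2 := by
    calc (∑ i, bit (a i) * z i) ^ 2 ≤ (∑ i, bit (a i) ^ 2) * ∑ i, z i ^ 2 :=
          Finset.sum_mul_sq_le_sq_mul_sq _ _ _
      _ ≤ _ := by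
          refine mul_le_mul_of_nonneg_right ?_ (Finset.sum_nonneg fun i _ => sq_nonneg _)
          refine le_trans (le_of_eq (Finset.sum_congr rfl fun i _ => ?_)) hb1
          rcases hb i with h | h <;> simp [h]
  have h3 := mul_le_mul_of_nonneg_right h1 (sq_nonneg y)
  nlinarith [sq_nonneg ((1 - ∑ i, bit (a i)) * y - ∑ i, bit (a i) * z i)]

/-- Number of trajectories in which the action of step `h` is `a`. -/
def visits {K : ℕ} (D : Dataset K H Bool (Fin n → Bool)) (h : Fin H) (a : Fin n → Bool) : ℕ :=
  (Finset.univ.filter fun τ => (D τ h).1.2 = a).card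

theorem sum_probe_visits_le {K : ℕ} (D : Dataset K H Bool (Fin n → Bool)) (h : Fin H)
    (f : (Fin n → Bool) → ℝ) (hf : ∀ a, 0 ≤ f a) :
    ∑ o, visits D h (probe o) * f (probe o) ≤ ∑ τ, f (D τ h).1.2 := by
  have h1 : ∑ τ, f (D τ h).1.2 = ∑ a, visits D h a * f a := by
    rw [← Finset.sum_fiberwise_of_maps_to (t := Finset.univ) (g := fun τ => (D τ h).1.2)
      (by simp)]
    refine Finset.sum_congr rfl fun a _ => ?_
    rw [visits, ← nsmul_eq_mul, ← Finset.sum_const]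
    exact Finset.sum_congr rfl fun τ hτ => by rw [(Finset.mem_filter.1 hτ).2]
  rw [h1, ← Finset.sum_image (s := Finset.univ) (g := probe)
    (f := fun a => (visits D h a : ℝ) * f a) probe_injective.injOn]
  exact Finset.sum_le_univ_sum_of_nonneg fun a => mul_nonneg (Nat.cast_nonneg _) (hf a)

/-- For f the feature and v = Z⁻¹f, the visit counts give κ(f·v)² ≤ v·Zv = f·v with κ = K/(8n²),
hence f·v ≤ 1/κ. The ridge term only helps. -/
theorem wnorm_Zstar_inv_le {K : ℕ} (hn : n ≠ 0) (hK : 0 < K) {lam : ℝ} (hlam : 0 < lam)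
    (D : Dataset K H Bool (Fin n → Bool)) (h : Fin H)
    (hD : ∀ o, K * probeWeight n o / 2 ≤ visits D h (probe o)) (x : Bool) (a : Fin n → Bool) :
    wnorm ((hardMDP hε hεn u).Zstar feature lam D h)⁻¹ (feature x a) ≤ √(8 * n ^ 2 / K) := by
  have hn' : (0 : ℝ) < n := by positivity
  have hK' : (0 : ℝ) < K := by exact_mod_cast hK
  set Z := (hardMDP hε hεn u).Zstar feature lam D h with hZ
  have hZq : ∀ v, v ⬝ᵥ (Z *ᵥ v) =
      ∑ τ, ((feature true (D τ h).1.2).ofLp ⬝ᵥ v) ^ 2 + lam * (v ⬝ᵥ v) := by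
    intro v
    simp only [hZ, MDP.Zstar, truncVar_eq, inv_one, one_smul]
    rw [Matrix.add_mulVec, dotProduct_add, Matrix.sum_mulVec, dotProduct_sum,
      Matrix.smul_mulVec, Matrix.one_mulVec, dotProduct_smul, smul_eq_mul]
    simp only [vecMulVec_quadForm]
    rfl
  have hlow : ∀ v : Fin (n + 1) → ℝ, K / (4 * n ^ 2) / 2 * ((feature x a).ofLp ⬝ᵥ v) ^ 2 ≤
      ∑ τ, ((feature true (D τ h).1.2).ofLp ⬝ᵥ v) ^ 2 := by
    intro v
    refine le_trans ?_ (sum_probe_visits_le D h (fun a => ((feature true a).ofLp ⬝ᵥ v) ^ 2)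
      fun a => sq_nonneg _)
    calc _ ≤ (K : ℝ) / (4 * (n : ℝ) ^ 2) / 2 *
          (2 * n ^ 2 * ((feature true (probe none)).ofLp ⬝ᵥ v) ^ 2 +
            2 * n * ∑ i, ((feature true (probe (some i))).ofLp ⬝ᵥ v) ^ 2) :=
          mul_le_mul_of_nonneg_left (feature_dot_sq_le hn x true a v) (by positivity)
      -- The factor K/(8n²) turns 2n² and 2n into K/4 and K/(4n), exactly half the expected counts
      -- of the probes.
      _ = ∑ o, K * probeWeight n o / 2 * ((feature true (probe o)).ofLp ⬝ᵥ v) ^ 2 := by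
          simp only [Fintype.sum_option, probeWeight, Option.elim, ← Finset.mul_sum]
          field_simp
          norm_num
      _ ≤ _ := Finset.sum_le_sum fun o _ => mul_le_mul_of_nonneg_right (hD o) (sq_nonneg _)
  have hpos : Z.PosDef := by
    refine Matrix.PosDef.of_dotProduct_mulVec_pos ?_ fun v hv => ?_
    · refine Matrix.IsHermitian.ext fun i j => ?_
      simp [hZ, MDP.Zstar, Matrix.sum_apply, Matrix.vecMulVec_apply, Matrix.one_apply, mul_comm,
        eq_comm]
    · rw [star_trivial, hZq]
      refine add_pos_of_nonneg_of_pos (Finset.sum_nonneg fun τ _ => sq_nonneg _)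
        (mul_pos hlam ?_)
      have := Matrix.dotProduct_star_self_pos_iff.2 hv
      simpa using this
  refine Real.sqrt_le_sqrt ?_
  set f := (feature x a).ofLp with hf
  set v := Z⁻¹ *ᵥ f with hv
  have hZv : Z *ᵥ v = f := by
    rw [hv, Matrix.mulVec_mulVec, Matrix.mul_nonsing_inv _ ((Matrix.isUnit_iff_isUnit_det _).1
      hpos.isUnit), Matrix.one_mulVec]
  have h1 := hZq v
  rw [hZv, dotProduct_comm] at h1
  have h2 := hlow v
  have h3 : 0 ≤ lam * (v ⬝ᵥ v) :=
    mul_nonneg hlam.le (Finset.sum_nonneg fun i _ => mul_self_nonneg _)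
  have h4 : K / (4 * n ^ 2) / 2 * (f ⬝ᵥ v) ^ 2 ≤ f ⬝ᵥ v := by linarith
  by_contra hcon
  push Not at hcon
  have hpos' : 0 < f ⬝ᵥ v := lt_trans (by positivity) hcon
  have h5 : (1 : ℝ) < K / (4 * n ^ 2) / 2 * (f ⬝ᵥ v) := by
    calc (1 : ℝ) = K / (4 * n ^ 2) / 2 * (8 * n ^ 2 / K) := by field_simp; norm_num
      _ < _ := by gcongr
  nlinarith

/-! ### The likelihood of a dataset -/

/-- Probability of the outcome `y`, a state, an action and a reward bit, in step `h`. -/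
def stepProb (ε : ℝ) (u : Fin H × Fin n → Bool) (h : Fin H)
    (y : (Bool × (Fin n → Bool)) × Bool) : ℝ :=
  1 / 2 * probeDist n y.1.2 * bernWeight (meanReward ε (fun i => u (h, i)) y.1.2) y.2

/-- The dataset with the given outcomes. -/
def toDataset {K : ℕ} (ω : Fin K → Fin H → (Bool × (Fin n → Bool)) × Bool) :
    Dataset K H Bool (Fin n → Bool) :=
  fun τ h => ((ω τ h).1, bit (ω τ h).2)

/-- The likelihood of the outcomes `ω`. -/
def likelihood {K : ℕ} (ε : ℝ) (u : Fin H × Fin n → Bool)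
    (ω : Fin K → Fin H → (Bool × (Fin n → Bool)) × Bool) : ℝ :=
  ∏ τ, ∏ h, stepProb ε u h (ω τ h)

include hε hεn in
theorem stepProb_nonneg (h : Fin H) (y : (Bool × (Fin n → Bool)) × Bool) :
    0 ≤ stepProb ε u h y :=
  mul_nonneg (mul_nonneg (by norm_num) (probeDist_nonneg n _))
    (bernWeight_nonneg (meanReward_mem hε hεn _ _) _)

include hε hεn in
theorem likelihood_nonneg {K : ℕ} (ω : Fin K → Fin H → (Bool × (Fin n → Bool)) × Bool) :
    0 ≤ likelihood ε u ω :=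
  Finset.prod_nonneg fun _ _ => Finset.prod_nonneg fun _ _ => stepProb_nonneg hε hεn u _ _

theorem sum_outcome (f : (Fin n → Bool) → Bool → ℝ) :
    ∑ y : (Bool × (Fin n → Bool)) × Bool, 1 / 2 * probeDist n y.1.2 * f y.1.2 y.2 =
      ∑ o, probeWeight n o * ∑ b, f (probe o) b := by
  rw [← sum_probeDist_mul fun a => ∑ b, f a b]
  simp only [Fintype.sum_prod_type, ← Finset.mul_sum, mul_assoc]
  rw [Finset.sum_const]
  simp

theorem sum_stepProb (hn : n ≠ 0) (h : Fin H) : ∑ y, stepProb ε u h y = 1 := by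
  simp only [stepProb]
  rw [sum_outcome fun a b => bernWeight (meanReward ε (fun i => u (h, i)) a) b]
  simp only [sum_bernWeight, mul_one, sum_probeWeight hn]

theorem sum_prod_prod {K : ℕ} {Y : Type*} [Fintype Y] (g : Fin H → Y → ℝ) :
    ∑ ω : Fin K → Fin H → Y, ∏ τ, ∏ h, g h (ω τ h) = (∏ h, ∑ y, g h y) ^ K := by
  rw [← Fintype.prod_sum fun (_ : Fin K) (s : Fin H → Y) => ∏ h, g h (s h)]
  simp only [← Fintype.prod_sum fun h y => g h y, Finset.prod_const, Finset.card_univ,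
    Fintype.card_fin]

theorem sum_likelihood {K : ℕ} (hn : n ≠ 0) :
    ∑ ω : Fin K → _, likelihood ε u ω = 1 := by
  simp only [likelihood]
  rw [sum_prod_prod (stepProb ε u)]
  simp [sum_stepProb u hn]

theorem dirac_prod_bernLaw {X : Type*} [MeasurableSpace X] (x : X) (p : ℝ) :
    (Measure.dirac x).prod (bernLaw p) =
      ∑ b, ENNReal.ofReal (bernWeight p b) • Measure.dirac (x, bit b) := by
  have : SFinite (bernLaw p) := by
    rw [bernLaw, Fintype.sum_bool]
    infer_instance
  rw [Measure.dirac_prod, bernLaw, Fintype.sum_bool, Fintype.sum_bool,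
    Measure.map_add _ _ measurable_prodMk_left]
  simp only [Measure.map_smul, Measure.map_dirac' measurable_prodMk_left]

/-- Constant transition probabilities make the path probability a product over steps, so the steps
of a trajectory are independent. -/
theorem trajLaw_eq (hn : n ≠ 0) :
    (hardMDP hε hεn u).trajLaw unifState (behavior n H hn) =
      Measure.pi fun h => ∑ y, ENNReal.ofReal (stepProb ε u h y) •
        Measure.dirac (y.1, bit y.2) := by
  have hstep : ∀ h : Fin H, ∑ y, ENNReal.ofReal (stepProb ε u h y) •
      Measure.dirac (y.1, bit y.2) = ∑ z : Bool × (Fin n → Bool),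
        ENNReal.ofReal (1 / 2 * probeDist n z.2) •
          (Measure.dirac z).prod ((hardMDP hε hεn u).R h z.1 z.2) := by
    intro h
    rw [Fintype.sum_prod_type]
    refine Finset.sum_congr rfl fun z _ => ?_
    simp only [hardMDP]
    rw [dirac_prod_bernLaw, Finset.smul_sum]
    refine Finset.sum_congr rfl fun b _ => ?_
    rw [smul_smul, ← ENNReal.ofReal_mul (mul_nonneg (by norm_num) (probeDist_nonneg n _))]
    rfl
  have := (hardMDP hε hεn u).R_prob
  simp only [hstep]
  rw [pi_sum_smul _ fun _ _ => ENNReal.ofReal_ne_top]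
  refine Finset.sum_congr rfl fun s _ => ?_
  rw [pathProb_eq, ENNReal.ofReal_prod_of_nonneg fun h _ =>
    mul_nonneg (by norm_num) (((behavior n H hn).2 h _).1 _)]
  rfl

theorem dataLaw_eq {K : ℕ} (hn : n ≠ 0) :
    (hardMDP hε hεn u).dataLaw K unifState (behavior n H hn) =
      ∑ ω : Fin K → _, ENNReal.ofReal (likelihood ε u ω) • Measure.dirac (toDataset ω) := by
  rw [MDP.dataLaw, trajLaw_eq, pi_sum_dirac (stepProb ε u) (stepProb_nonneg hε hεn u),
    pi_sum_dirac
      (fun (_ : Fin K) (s : Fin H → (Bool × (Fin n → Bool)) × Bool) => ∏ h, stepProb ε u h (s h))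
      fun _ _ => Finset.prod_nonneg fun _ _ => stepProb_nonneg hε hεn u _ _]
  rfl

theorem expSubopt_eq {K : ℕ} (hn : n ≠ 0)
    (alg : Dataset K H Bool (Fin n → Bool) → Policy H Bool (Fin n → Bool)) :
    (hardMDP hε hεn u).expSubopt unifState (behavior n H hn) alg =
      ε * ∑ ω, likelihood ε u ω * ∑ j, errProb (alg (toDataset ω)) j (u j) := by
  rw [MDP.expSubopt, dataLaw_eq, integral_sum_dirac _ (likelihood_nonneg hε hεn u),
    Finset.mul_sum]
  refine Finset.sum_congr rfl fun ω _ => ?_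
  simp only [unifState]
  rw [regret_eq]
  ring

/-! ### Indistinguishability of neighboring instances -/

theorem meanReward_probe_none (v : Fin n → Bool) : meanReward ε v (probe none) = 1 / 2 := by
  simp [meanReward, probe]

theorem meanReward_probe_some (v : Fin n → Bool) (j : Fin n) :
    meanReward ε v (probe (some j)) = 1 / 2 + ε * if v j then 1 else -1 := by
  simp [meanReward, probe]

theorem bern_affinity_self {p : ℝ} (hp : p ∈ Set.Icc (0 : ℝ) 1) :
    ∑ b, √(bernWeight p b * bernWeight p b) = 1 := by
  simp only [Real.sqrt_mul_self (bernWeight_nonneg hp _), sum_bernWeight]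

/-- Both summands equal √t with t = p(1 - p) ≤ 1/4, and √t ≥ 2t there. For p = 1/2 ± ε the bound
reads 1 - 4ε². -/
theorem bern_affinity_ge {p q : ℝ} (hp : p ∈ Set.Icc (0 : ℝ) 1) (hpq : p + q = 1) :
    4 * (p * q) ≤ ∑ b, √(bernWeight p b * bernWeight q b) := by
  obtain rfl : q = 1 - p := by linarith
  have h0 : 0 ≤ p * (1 - p) := mul_nonneg hp.1 (by linarith [hp.2])
  have h : 2 * (p * (1 - p)) ≤ √(p * (1 - p)) :=
    Real.le_sqrt_of_sq_le (by nlinarith [sq_nonneg (2 * p - 1)])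
  have h1 : (1 - p) * (1 - (1 - p)) = p * (1 - p) := by ring
  simp only [Fintype.sum_bool, bernWeight, if_true, Bool.false_eq_true, if_false, h1]
  linarith

include hε hεn in
theorem step_affinity_of_ne (hn : n ≠ 0) (j : Fin H × Fin n) {h : Fin H} (hh : h ≠ j.1) :
    ∑ y, √(stepProb ε u h y * stepProb ε (flipAt j u) h y) = 1 := by
  have : ∀ y, stepProb ε (flipAt j u) h y = stepProb ε u h y := by
    intro y
    have : ∀ i, flipAt j u (h, i) = u (h, i) := fun i =>
      flipAt_of_ne (fun he => hh (congrArg Prod.fst he)) u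
    simp only [stepProb, this]
  simp only [this, Real.sqrt_mul_self (stepProb_nonneg hε hεn u h _)]
  exact sum_stepProb u hn h

include hε hεn in
-- Only the unit vector of the flipped coordinate separates the two laws: it has weight 1/(2n) and
-- loses at most 4ε² of affinity.
theorem step_affinity_same (hn : n ≠ 0) (j : Fin H × Fin n) :
    1 - 2 * ε ^ 2 / n ≤ ∑ y, √(stepProb ε u j.1 y * stepProb ε (flipAt j u) j.1 y) := by
  have hn' : (0 : ℝ) < n := by positivity
  have hsq : ∀ y, √(stepProb ε u j.1 y * stepProb ε (flipAt j u) j.1 y) =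
      1 / 2 * probeDist n y.1.2 *
        √(bernWeight (meanReward ε (fun i => u (j.1, i)) y.1.2) y.2 *
          bernWeight (meanReward ε (fun i => flipAt j u (j.1, i)) y.1.2) y.2) := by
    intro y
    rw [stepProb, stepProb, mul_mul_mul_comm, Real.sqrt_mul (mul_self_nonneg _),
      Real.sqrt_mul_self (mul_nonneg (by norm_num) (probeDist_nonneg n _))]
  simp only [hsq]
  rw [sum_outcome fun a b => √(bernWeight (meanReward ε (fun i => u (j.1, i)) a) b *
    bernWeight (meanReward ε (fun i => flipAt j u (j.1, i)) a) b)]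
  have hlow : ∀ o, (1 : ℝ) - (if o = some j.2 then 4 * ε ^ 2 else 0) ≤
      ∑ b, √(bernWeight (meanReward ε (fun i => u (j.1, i)) (probe o)) b *
        bernWeight (meanReward ε (fun i => flipAt j u (j.1, i)) (probe o)) b) := by
    intro o
    have hmem := meanReward_mem hε hεn (fun i => u (j.1, i)) (probe o)
    by_cases ho : o = some j.2
    · subst ho
      have hflip : flipAt j u (j.1, j.2) = !u (j.1, j.2) := flipAt_same j u
      refine le_trans (le_of_eq ?_) (bern_affinity_ge hmem ?_)
      · rw [meanReward_probe_some, meanReward_probe_some, hflip]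
        cases u (j.1, j.2) <;> simp <;> ring
      · rw [meanReward_probe_some, meanReward_probe_some, hflip]
        cases u (j.1, j.2) <;> simp <;> ring
    · have : meanReward ε (fun i => flipAt j u (j.1, i)) (probe o) =
          meanReward ε (fun i => u (j.1, i)) (probe o) := by
        cases o with
        | none => rw [meanReward_probe_none, meanReward_probe_none]
        | some k =>
          have hk : k ≠ j.2 := fun hk => ho (by rw [hk])
          rw [meanReward_probe_some, meanReward_probe_some,
            flipAt_of_ne fun he => hk (congrArg Prod.snd he)]
      rw [this, bern_affinity_self hmem]
      simp [ho]
  calc 1 - 2 * ε ^ 2 / n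
      = ∑ o, probeWeight n o * ((1 : ℝ) - if o = some j.2 then 4 * ε ^ 2 else 0) := by
        simp only [mul_sub, Finset.sum_sub_distrib, mul_one, sum_probeWeight hn]
        simp only [mul_ite, mul_zero, Finset.sum_ite_eq', Finset.mem_univ, if_true]
        simp only [probeWeight, Option.elim]
        field_simp
        ring
    _ ≤ _ := Finset.sum_le_sum fun o _ =>
        mul_le_mul_of_nonneg_left (hlow o) (probeWeight_nonneg n o)

include hε hεn in
theorem sum_min_likelihood_ge {K : ℕ} (hn : n ≠ 0) (hK : 16 * K * ε ^ 2 ≤ n)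
    (hε1 : ε ≤ 1) (j : Fin H × Fin n) :
    1 / 2 ≤ ∑ ω : Fin K → _, min (likelihood ε u ω) (likelihood ε (flipAt j u) ω) := by
  have hn' : (0 : ℝ) < n := by positivity
  have hn1 : (1 : ℝ) ≤ n := by exact_mod_cast Nat.one_le_iff_ne_zero.2 hn
  refine le_trans ?_ (sum_min_ge_affinity (likelihood_nonneg hε hεn u)
    (likelihood_nonneg hε hεn _) (sum_likelihood u hn) (sum_likelihood _ hn))
  -- Affinity is multiplicative over independent trajectories and steps, and all steps but that of
  -- `j` contribute 1.
  have haff : ∑ ω : Fin K → _, √(likelihood ε u ω * likelihood ε (flipAt j u) ω) =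
      (∑ y, √(stepProb ε u j.1 y * stepProb ε (flipAt j u) j.1 y)) ^ K := by
    have h1 : ∀ ω : Fin K → Fin H → (Bool × (Fin n → Bool)) × Bool,
        √(likelihood ε u ω * likelihood ε (flipAt j u) ω) =
          ∏ τ, ∏ h, √(stepProb ε u h (ω τ h) * stepProb ε (flipAt j u) h (ω τ h)) := by
      intro ω
      have h2 : ∀ τ h, 0 ≤ stepProb ε u h (ω τ h) * stepProb ε (flipAt j u) h (ω τ h) :=
        fun τ h => mul_nonneg (stepProb_nonneg hε hεn _ _ _) (stepProb_nonneg hε hεn _ _ _)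
      simp only [likelihood, ← Finset.prod_mul_distrib]
      rw [Real.sqrt_prod _ fun τ _ => Finset.prod_nonneg fun h _ => h2 τ h]
      exact Finset.prod_congr rfl fun τ _ => Real.sqrt_prod _ fun h _ => h2 τ h
    simp only [h1]
    rw [sum_prod_prod fun h y => √(stepProb ε u h y * stepProb ε (flipAt j u) h y),
      Finset.prod_eq_single j.1 (fun h _ hh => step_affinity_of_ne hε hεn u hn j hh) (by simp)]
  rw [haff]
  have hx : 2 * ε ^ 2 / n ≤ 2 := by
    rw [div_le_iff₀ hn']
    nlinarith
  -- Bernoulli's inequality; the loss is at most 1/8 by the choice of ε, leaving affinity 7/8.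
  have hb : (1 : ℝ) - K * (2 * ε ^ 2 / n) ≤ (1 - 2 * ε ^ 2 / n) ^ K := by
    have := one_add_mul_le_pow (a := -(2 * ε ^ 2 / n)) (by linarith) K
    rw [← sub_eq_add_neg] at this
    linarith
  have hKb : K * (2 * ε ^ 2 / n) ≤ 1 / 8 := by
    rw [← mul_div_assoc, div_le_iff₀ hn']
    linarith
  have hε2 : ε ≤ 1 / 2 := le_trans (by nlinarith) hεn
  have hx1 : 0 ≤ 1 - 2 * ε ^ 2 / n := by
    rw [sub_nonneg, div_le_one hn']
    nlinarith
  have := pow_le_pow_left₀ hx1 (step_affinity_same hε hεn u hn j) K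
  linarith

include hε hεn in
theorem exists_expSubopt_ge {K : ℕ} (hn : n ≠ 0) (hK : 16 * K * ε ^ 2 ≤ n) (hε1 : ε ≤ 1)
    (alg : Dataset K H Bool (Fin n → Bool) → Policy H Bool (Fin n → Bool)) :
    ∃ u, ε * (H * n) / 4 ≤
      (hardMDP hε hεn u).expSubopt unifState (behavior n H hn) alg := by
  obtain ⟨u, hu⟩ := exists_assouad (fun u (ω : Fin K → _) => likelihood ε u ω)
    (fun j ω b => errProb (alg (toDataset ω)) j b) (fun _ _ _ => errProb_nonneg _ _ _)
    (fun _ _ _ => errProb_add_not _ _ _) (1 / 2)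
    (fun j u => sum_min_likelihood_ge hε hεn u hn hK hε1 j)
  refine ⟨u, ?_⟩
  rw [expSubopt_eq]
  rw [Fintype.card_prod, Fintype.card_fin, Fintype.card_fin, Nat.cast_mul] at hu
  have := mul_le_mul_of_nonneg_left hu hε
  linarith

/-! ### Concentration of the visit counts -/

include hε hεn in
theorem sum_likelihood_bad_le {K : ℕ} (hn : n ≠ 0) (h : Fin H) (o : Option (Fin n)) :
    ∑ ω : Fin K → Fin H → (Bool × (Fin n → Bool)) × Bool with
      (visits (toDataset ω) h (probe o) : ℝ) < K * probeWeight n o / 2, likelihood ε u ω ≤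
      Real.exp (-(K * probeWeight n o / 10)) := by
  refine chernoff_lower (fun s : Fin H → _ => ∏ h, stepProb ε u h (s h))
    (fun s => Finset.prod_nonneg fun h _ => stepProb_nonneg hε hεn u _ _) ?_
    (fun s => (s h).1.2 = probe o) _ ?_
  · rw [← Fintype.prod_sum (stepProb ε u)]
    simp [sum_stepProb u hn]
  · rw [Finset.sum_filter]
    have h1 : ∀ s : Fin H → (Bool × (Fin n → Bool)) × Bool,
        (if (s h).1.2 = probe o then ∏ k, stepProb ε u k (s k) else 0) =
          ∏ k, (stepProb ε u k (s k) *
            if k = h then (if (s k).1.2 = probe o then 1 else 0) else 1) := by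
      intro s
      simp only [Finset.prod_mul_distrib, Finset.prod_ite_eq', Finset.mem_univ, if_true]
      split_ifs <;> simp
    simp only [h1]
    rw [← Fintype.prod_sum fun k (y : (Bool × (Fin n → Bool)) × Bool) => stepProb ε u k y *
      if k = h then (if y.1.2 = probe o then 1 else 0) else 1, Finset.prod_eq_single h]
    · simp only [if_true, stepProb, mul_assoc]
      simp only [← mul_assoc (1 / 2 : ℝ)]
      rw [sum_outcome fun a b => bernWeight (meanReward ε (fun i => u (h, i)) a) b *
        if a = probe o then 1 else 0]
      simp only [← Finset.sum_mul, sum_bernWeight, one_mul, probe_injective.eq_iff]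
      simp
    · intro k _ hk
      simp [hk, sum_stepProb u hn]
    · simp

include hε hεn in
-- Union bound over H(n + 1) pairs of a step and a probe, each failing with probability at most
-- δ/(2H(n + 1)). The smallest weight 1/(2n) in the exponent Kρ/10 explains the factor 20n.
theorem sum_likelihood_good_ge {K : ℕ} {δ : ℝ} (hδ : 0 < δ) (hn : n ≠ 0) (hH : H ≠ 0)
    (hK : 20 * n * Real.log (2 * H * (n + 1) / δ) ≤ K) :
    1 - δ ≤ ∑ ω : Fin K → Fin H → (Bool × (Fin n → Bool)) × Bool with
      ∀ h o, K * probeWeight n o / 2 ≤ visits (toDataset ω) h (probe o), likelihood ε u ω := by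
  classical
  have hn1 : (1 : ℝ) ≤ n := by exact_mod_cast Nat.one_le_iff_ne_zero.2 hn
  have hH1 : (1 : ℝ) ≤ H := by exact_mod_cast Nat.one_le_iff_ne_zero.2 hH
  have hbad : ∀ (h : Fin H) o, ∑ ω : Fin K → Fin H → (Bool × (Fin n → Bool)) × Bool with
      (visits (toDataset ω) h (probe o) : ℝ) < K * probeWeight n o / 2, likelihood ε u ω ≤
      δ / (2 * H * (n + 1)) := by
    intro h o
    refine (sum_likelihood_bad_le hε hεn u hn h o).trans ?_
    have hw : 1 / (2 * n) ≤ probeWeight n o := by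
      cases o
      · simp only [probeWeight, Option.elim]
        rw [div_le_div_iff₀ (by positivity) (by norm_num)]
        linarith
      · simp [probeWeight]
    have h1 : Real.log (2 * H * (n + 1) / δ) ≤ K * probeWeight n o / 10 := by
      calc Real.log (2 * H * (n + 1) / δ) ≤ K / (20 * n) := by
            rw [le_div_iff₀ (by positivity)]
            linarith
        _ = K * (1 / (2 * n)) / 10 := by
            field_simp
            ring
        _ ≤ _ := by gcongr
    calc Real.exp (-(K * probeWeight n o / 10))
        ≤ Real.exp (-Real.log (2 * H * (n + 1) / δ)) := by gcongr
      _ = δ / (2 * H * (n + 1)) := by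
          rw [Real.exp_neg, Real.exp_log (by positivity), inv_div]
  have hpt : ∀ ω : Fin K → Fin H → (Bool × (Fin n → Bool)) × Bool, likelihood ε u ω ≤
      (if ∀ h o, K * probeWeight n o / 2 ≤ visits (toDataset ω) h (probe o)
        then likelihood ε u ω else 0) +
      ∑ h, ∑ o, if (visits (toDataset ω) h (probe o) : ℝ) < K * probeWeight n o / 2
        then likelihood ε u ω else 0 := by
    intro ω
    have h0 := likelihood_nonneg hε hεn u ω
    have h1 : ∀ (h : Fin H) (o : Option (Fin n)), 0 ≤
        (if (visits (toDataset ω) h (probe o) : ℝ) < K * probeWeight n o / 2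
          then likelihood ε u ω else 0) := fun h o => by split_ifs <;> simp [h0]
    split_ifs with hgood
    · exact le_add_of_nonneg_right (Finset.sum_nonneg fun h _ =>
        Finset.sum_nonneg fun o _ => h1 h o)
    · push Not at hgood
      obtain ⟨h, o, hho⟩ := hgood
      rw [zero_add]
      refine le_trans ?_ (Finset.single_le_sum (f := fun h => ∑ o : Option (Fin n), _)
        (fun h _ => Finset.sum_nonneg fun o _ => h1 h o) (Finset.mem_univ h))
      refine le_trans ?_ (Finset.single_le_sum (fun o _ => h1 h o) (Finset.mem_univ o))
      rw [if_pos hho]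
  have hsum := Finset.sum_le_sum fun ω (_ : ω ∈ Finset.univ) => hpt ω
  rw [sum_likelihood u hn, Finset.sum_add_distrib, ← Finset.sum_filter, Finset.sum_comm] at hsum
  have hb : ∑ h : Fin H, ∑ ω : Fin K → Fin H → (Bool × (Fin n → Bool)) × Bool,
      ∑ o, (if (visits (toDataset ω) h (probe o) : ℝ) < K * probeWeight n o / 2
        then likelihood ε u ω else 0) ≤ δ := by
    calc _ ≤ ∑ _h : Fin H, ∑ _o : Option (Fin n), δ / (2 * H * (n + 1)) := by
          refine Finset.sum_le_sum fun h _ => ?_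
          rw [Finset.sum_comm]
          refine Finset.sum_le_sum fun o _ => ?_
          rw [← Finset.sum_filter]
          exact hbad h o
      _ = δ / 2 := by
          simp
          field_simp
      _ ≤ δ := by linarith
  linarith

end

end OfflineRL

end

/-! ### Choice of the constants and conclusion -/

theorem theorem3 :
    ∃ c c₀ C : ℝ, 0 < c ∧ 0 < c₀ ∧ 0 < C ∧
      ∀ (H d K : ℕ) (δ : ℝ), 1 ≤ H → 2 ≤ d → 0 < δ → δ < 1 →
        C * (d : ℝ) ^ 4 * Real.log (2 * (H : ℝ) * (d : ℝ) / δ) ≤ (K : ℝ) →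
        ∃ (S A : Type) (_ : Fintype S) (_ : Fintype A)
          (_ : MeasurableSpace S) (_ : MeasurableSingletonClass S)
          (_ : MeasurableSpace A) (_ : MeasurableSingletonClass A)
          (φ : S → A → EuclideanSpace ℝ (Fin d))
          (ξ : S → ℝ) (β : OfflineRL.Policy H S A) (𝓜 : Set (OfflineRL.MDP H S A)),
          ξ ∈ stdSimplex ℝ S ∧ 𝓜.Nonempty ∧
          (∀ M ∈ 𝓜, M.IsLinear φ) ∧
          (∀ M ∈ 𝓜, ∀ h : Fin H,
            (M.covMatrix φ ξ β h -
              (c₀ / (d : ℝ) ^ 2) • (1 : Matrix (Fin d) (Fin d) ℝ)).PosSemidef) ∧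
          (∀ M ∈ 𝓜, ∃ πs : OfflineRL.Policy H S A, M.IsOptimal πs) ∧
          ∀ alg : OfflineRL.Dataset K H S A → OfflineRL.Policy H S A, Measurable alg →
          ∀ lam : ℝ, 0 < lam →
          ∀ M ∈ 𝓜, ∀ πs : OfflineRL.Policy H S A, M.IsOptimal πs →
            ENNReal.ofReal (1 - δ) ≤ M.dataLaw K ξ β
              {D | c * √(d : ℝ) * ∑ h : Fin H, M.expect ξ πs h
                      (fun x a => OfflineRL.wnorm (M.Zstar φ lam D h)⁻¹ (φ x a)) ≤
                    ⨆ M' : 𝓜, M'.1.expSubopt ξ β alg} := by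
  refine ⟨1 / 100, 1 / 12, 20, by norm_num, by norm_num, by norm_num, ?_⟩
  intro H d K δ hH hd hδ hδ1 hK
  obtain ⟨n, rfl⟩ : ∃ n, d = n + 1 := ⟨d - 1, by omega⟩
  have hn : n ≠ 0 := by omega
  have hn1 : (1 : ℝ) ≤ n := by exact_mod_cast Nat.one_le_iff_ne_zero.2 hn
  have hn' : (0 : ℝ) < n := by linarith
  have hH1 : (1 : ℝ) ≤ H := by exact_mod_cast hH
  push_cast at hK
  set L := Real.log (2 * (H : ℝ) * ((n : ℝ) + 1) / δ) with hL
  have hL1 : 1 ≤ L := by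
    rw [hL, Real.le_log_iff_exp_le (by positivity), le_div_iff₀ hδ]
    have := Real.exp_one_lt_d9
    have hHn : 4 ≤ 2 * (H : ℝ) * ((n : ℝ) + 1) := by nlinarith
    nlinarith
  have hpow : (n : ℝ) ^ 3 ≤ ((n : ℝ) + 1) ^ 4 :=
    (pow_le_pow_right₀ hn1 (by norm_num : 3 ≤ 4)).trans (by gcongr; linarith)
  have hpow1 : (n : ℝ) ≤ n ^ 3 := le_self_pow₀ hn1 (by norm_num)
  have hKn : 20 * (n : ℝ) * L ≤ K := by
    refine le_trans ?_ hK
    have : (n : ℝ) ≤ ((n : ℝ) + 1) ^ 4 := hpow1.trans hpow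
    gcongr
  have hKn3 : 20 * (n : ℝ) ^ 3 ≤ K := by
    refine le_trans ?_ hK
    nlinarith [pow_pos hn' 3]
  have hK0 : (0 : ℝ) < K := lt_of_lt_of_le (by positivity) hKn3
  -- The largest ε with 16Kε² ≤ n, at which neighboring instances stay indistinguishable. Means in
  -- [0,1] need εn ≤ 1/2, which follows from K ≥ 20n³.
  set ε := √(n / K : ℝ) / 4 with hεdef
  have hε : 0 ≤ ε := by positivity
  have hε2 : ε ^ 2 = n / K / 16 := by
    rw [hεdef, div_pow, Real.sq_sqrt (by positivity)]
    norm_num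
  have hεn : ε * n ≤ 1 / 2 := by
    refine le_of_sq_le_sq ?_ (by norm_num)
    rw [mul_pow, hε2]
    have : (n : ℝ) / K / 16 * n ^ 2 = n ^ 3 / (16 * K) := by field_simp
    rw [this, div_le_iff₀ (by positivity)]
    nlinarith
  have hε1 : ε ≤ 1 := by nlinarith
  have hKε : 16 * K * ε ^ 2 ≤ n := by
    rw [hε2]
    field_simp
    exact le_refl _
  refine ⟨Bool, Fin n → Bool, inferInstance, inferInstance, inferInstance, inferInstance,
    inferInstance, inferInstance, OfflineRL.feature, OfflineRL.unifState,
    OfflineRL.behavior n H hn, Set.range (OfflineRL.hardMDP hε hεn),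
    OfflineRL.unifState_mem, Set.range_nonempty _, ?_, ?_, ?_, ?_⟩
  · rintro _ ⟨u, rfl⟩
    exact OfflineRL.hardMDP_isLinear hε hεn u hn
  · rintro _ ⟨u, rfl⟩ h
    exact OfflineRL.covMatrix_posSemidef hε hεn u hn h
  · rintro _ ⟨u, rfl⟩
    exact ⟨_, OfflineRL.greedy_isOptimal hε hεn u⟩
  rintro alg - lam hlam _ ⟨u, rfl⟩ πs -
  -- The bad instance `u'` depends on `alg` only and is unrelated to the instance `u` generating the
  -- data, so the supremum has a deterministic lower bound.
  obtain ⟨u', hu'⟩ := OfflineRL.exists_expSubopt_ge hε hεn hn hKε hε1 alg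
  have hsup : ε * (H * n) / 4 ≤ ⨆ M' : Set.range (OfflineRL.hardMDP (H := H) hε hεn),
      M'.1.expSubopt OfflineRL.unifState (OfflineRL.behavior n H hn) alg :=
    hu'.trans (le_ciSup (f := fun M' : Set.range (OfflineRL.hardMDP (H := H) hε hεn) =>
      M'.1.expSubopt OfflineRL.unifState (OfflineRL.behavior n H hn) alg)
      (Set.finite_range _).bddAbove ⟨_, u', rfl⟩)
  rw [OfflineRL.dataLaw_eq]
  refine (ENNReal.ofReal_le_ofReal (OfflineRL.sum_likelihood_good_ge hε hεn u hδ hn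
    (by omega) hKn)).trans (OfflineRL.sum_dirac_apply_ge _
      (OfflineRL.likelihood_nonneg hε hεn u) _ _ _ fun ω hω => ?_)
  have hgood := (Finset.mem_filter.1 hω).2
  refine le_trans ?_ hsup
  have hexp : ∑ h : Fin H, (OfflineRL.hardMDP hε hεn u).expect OfflineRL.unifState πs h
      (fun x a => OfflineRL.wnorm ((OfflineRL.hardMDP hε hεn u).Zstar OfflineRL.feature lam
        (OfflineRL.toDataset ω) h)⁻¹ (OfflineRL.feature x a)) ≤ H * √(8 * n ^ 2 / K) := by
    calc _ ≤ ∑ _h : Fin H, √(8 * n ^ 2 / K : ℝ) :=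
          Finset.sum_le_sum fun h _ => OfflineRL.expect_le hε hεn u πs h _ _ fun x a =>
            OfflineRL.wnorm_Zstar_inv_le hε hεn u hn (by exact_mod_cast hK0) hlam _ h
              (hgood h) x a
      _ = _ := by simp
  refine (mul_le_mul_of_nonneg_left hexp (by positivity)).trans ?_
  -- After squaring this is 8n²(n + 1) ≤ 16n³. The conclusion then needs 4c ≤ 1/16, which c = 1/100
  -- satisfies.
  have h1 : √((n + 1 : ℕ) : ℝ) * √(8 * n ^ 2 / K : ℝ) ≤ 4 * n * √(n / K : ℝ) := by
    rw [← Real.sqrt_mul (by positivity)]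
    refine Real.sqrt_le_iff.2 ⟨by positivity, ?_⟩
    rw [mul_pow, Real.sq_sqrt (by positivity)]
    push_cast
    rw [← mul_div_assoc, ← mul_div_assoc]
    refine div_le_div_of_nonneg_right ?_ hK0.le
    nlinarith [mul_nonneg (sq_nonneg (n : ℝ)) (sub_nonneg.2 hn1)]
  have h2 := mul_le_mul_of_nonneg_left h1 (by linarith : (0 : ℝ) ≤ H)
  have h3 : 0 ≤ (H : ℝ) * (n * √(n / K : ℝ)) := by positivity
  rw [hεdef]
  linarith
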